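/- **Theorem of residues, real-plane version.** Let $\mathcal K$ be the Kähler (Clifford) algebra of the Euclidean plane, generated by $dx,dy$ with $(dx)^2=(dy)^2=1$, $dx\,dy=-dy\,dx$, so that $(dxdy)^2=-1$. Write $a^{(2)}$ for the coefficient of $dxdy$ of $a\in\mathcal K$ in the basis $1,dx,dy,dxdy$; the elements $u+v\,dxdy$ form the (commutative) even subalgebra. Put $z=x+y\,dxdy$, and for a point $(x_0,y_0)$ put $z_0=x_0+y_0\,dxdy$ and $z'=z-z_0$; limits $z\to z_0$ are taken through points different from $(x_0,y_0)$. Let $D\subseteq\mathbb R^2$ be open and let $S\subseteq\mathbb R^2$ be a set of isolated points such that $D\setminus S$ is open. Let $\alpha=k\,dx+g\,dy=w\,dx$, with $w=k-g\,dxdy$, be a differentiable 1-form on $D\setminus S$ which is closed there, i.e. $\partial k/\partial y=\partial g/\partial x$. Let $\gamma$ be a closed piecewise $C^1$ curve in $D\setminus S$. A point is called enclosed by $\gamma$ if it is not on $\gamma$ and lies in a bounded connected component of the complement of $\gamma$. Assume that all points enclosed by $\gamma$ lie in $D$ and that $\gamma$ goes around each enclosed point of $S$ exactly once counterclockwise,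 i.e. $\frac1{2\pi}\oint_\gamma d\phi'=1$, where $\rho',\phi'$ are the polar coordinates centred at that point. Assume finally that, around each enclosed point of $S$, $w$ is given on a punctured neighbourhood by a convergent series $\sum_{n\in\mathbb Z}a_n z'^n$ of (positive, zero and negative) integer powers of $z'$ with coefficients in the even subalgebra. Then for each $q\in S$ enclosed by $\gamma$, with $z_0$ the value of $z$ at $q$, the function $(z-z_0)w$ is a series of integer powers of $z'$ near $q$; its constant term $c_q$ is uniquely determined; the enclosed points of $S$ are finite in number; $\alpha$ is integrable along $\gamma$; and $$\oint_\gamma\alpha=-2\pi\sum_{q\in S\ \text{enclosed by}\ \gamma}c_q^{(2)} .$$ Moreover: 1. For every point $q$ of the plane (not only those of $S$), the coefficient $j$ of $d\phi'$ in $\alpha=h\,d\rho'+j\,d\phi'$ (polar coordinates centred at $q$), that is, the value of $\alpha$ on $\partial/\partial\phi'$, is $j=-[(z-z_0)w]^{(2)}$. 2. For each $q\in S$ enclosed by $\gamma$, $\displaystyle\lim_{\rho_0\to0^+}\int_0^{2\pi}j(\rho_0,\phi')\,d\phi'=-2\pi\,c_q^{(2)}$. Say that a function $F$ has a pole of order $m$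 at $q$, with leading coefficient $a_m$, if $m$ is the smallest positive integer for which $(z-z_0)^mF$ tends to a nonzero limit as $z\to z_0$, and $a_m$ is that limit. 3. If $w$ has a simple pole (order $1$) at the enclosed point $q\in S$, then $\displaystyle c_q^{(2)}=\lim_{z\to z_0}[(z-z_0)w]^{(2)}$. 4. If $w$ has a pole of order $m$ at the enclosed point $q\in S$, with leading coefficient $a_m$, then $w-a_m/z'^m$, if it still has a pole at $q$, has one of order at most $m-1$; and the following procedure, started with $F=w$, terminates and yields exactly $c_q$: if $F$ has a pole of order $p\ge2$ at $q$ with leading coefficient $a_p$, replace $F$ by $F-a_p/z'^p$ (which then has no pole or a pole of order at most $p-1$) and repeat; if $F$ has a pole of order $1$, the result is $a_1=\lim_{z\to z_0}(z-z_0)F$; if $F$ tends to a limit as $z\to z_0$, the result is $0$. -/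

import Mathlib

open Filter Topology Set

noncomputable section

namespace KahlerPlane

/-! ### The Kähler (Clifford) algebra of the Euclidean plane -/

/-- The real plane, with Cartesian coordinates `(x, y)`. -/
abbrev Plane : Type := ℝ × ℝ

/-- The Clifford algebra of the covectors `k dx + g dy`, encoded as `(k, g)`, for the Euclidean
quadratic form `k ^ 2 + g ^ 2`. -/
abbrev KahlerAlgebra : Type := CliffordAlgebra (CliffordAlgebraQuaternion.Q (1 : ℝ) (1 : ℝ))

/-- The covector `k dx + g dy` as an element of the Kähler algebra. -/
def covector (k g : ℝ) : KahlerAlgebra :=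
  CliffordAlgebra.ι (CliffordAlgebraQuaternion.Q (1 : ℝ) (1 : ℝ)) (k, g)

def dx : KahlerAlgebra := covector 1 0

def dy : KahlerAlgebra := covector 0 1

def dxdy : KahlerAlgebra := dx * dy

/-- The element `u + v dxdy` of the even subalgebra. -/
def evenElem (u v : ℝ) : KahlerAlgebra := algebraMap ℝ KahlerAlgebra u + v • dxdy

/-- `z = x + y dxdy`. Thus `z' = z - z₀` at the point `p` is `zElem (p - q)`, where `q` is the
point that corresponds to `z₀`. -/
def zElem (p : Plane) : KahlerAlgebra := evenElem p.1 p.2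

/-- The coordinates of an element of the Kähler algebra in the basis `1, dx, dy, dxdy`. -/
def coords (a : KahlerAlgebra) : ℝ × ℝ × ℝ × ℝ :=
  let t := CliffordAlgebraQuaternion.toQuaternion a
  (t.re, t.imI, t.imJ, t.imK)

/-- The part `a ^ (0)`: the coordinate of `a` along `1`. -/
def scalarPart (a : KahlerAlgebra) : ℝ := (coords a).1

/-- The part `a ^ (2)`: the coordinate of `a` along `dxdy`. -/
def areaPart (a : KahlerAlgebra) : ℝ := (coords a).2.2.2

/-- The topology of the Kähler algebra as a four-dimensional real vector space: convergence means
convergence of the four coordinates. -/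
instance : TopologicalSpace KahlerAlgebra := TopologicalSpace.induced coords inferInstance

theorem coords_basis (s a b t : ℝ) :
    coords (algebraMap ℝ KahlerAlgebra s + a • dx + b • dy + t • dxdy) = (s, a, b, t) := by
  simp [coords, dx, dy, dxdy, covector]

theorem basis_coords (c : KahlerAlgebra) :
    c = algebraMap ℝ KahlerAlgebra (coords c).1 + (coords c).2.1 • dx + (coords c).2.2.1 • dy +
      (coords c).2.2.2 • dxdy :=
  (CliffordAlgebraQuaternion.ofQuaternion_toQuaternion c).symm

theorem covector_eq (k g : ℝ) : covector k g = k • dx + g • dy := by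
  simp [covector, dx, dy, ← map_smul, ← map_add]

theorem dx_mul_dx : dx * dx = 1 := by
  simp [dx, covector]

theorem dy_mul_dy : dy * dy = 1 := by
  simp [dy, covector]

theorem dy_mul_dx : dy * dx = -dxdy := by
  rw [dxdy, eq_neg_iff_add_eq_zero, dx, dy, covector, covector,
    CliffordAlgebra.ι_mul_ι_add_swap, QuadraticMap.polar]
  simp

theorem dxdy_mul_dx : dxdy * dx = -dy := by
  rw [dxdy, mul_assoc, dy_mul_dx, dxdy, mul_neg, ← mul_assoc, dx_mul_dx, one_mul]

theorem dxdy_mul_dxdy : dxdy * dxdy = -1 := by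
  rw [show dxdy * dxdy = dxdy * dx * dy by rw [dxdy]; simp only [mul_assoc], dxdy_mul_dx, neg_mul,
    dy_mul_dy]

theorem evenElem_mul (u v s t : ℝ) :
    evenElem u v * evenElem s t = evenElem (u * s - v * t) (u * t + v * s) := by
  simp only [evenElem, Algebra.algebraMap_eq_smul_one, add_mul, mul_add, smul_mul_smul_comm,
    one_mul, mul_one, dxdy_mul_dxdy]
  module

theorem areaPart_evenElem (u v : ℝ) : areaPart (evenElem u v) = v := by
  simp [areaPart, coords, evenElem, dxdy, dx, dy, covector]

theorem evenElem_one_zero : evenElem 1 0 = 1 := by simp [evenElem]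

/-- Off the origin `z` is invertible, so that `Ring.inverse` is its inverse. -/
theorem isUnit_zElem {p : Plane} (hp : p ≠ 0) : IsUnit (zElem p) := by
  have h : p.1 ^ 2 + p.2 ^ 2 ≠ 0 := fun h => hp <| by
    have h1 : p.1 = 0 := by nlinarith [sq_nonneg p.1, sq_nonneg p.2]
    have h2 : p.2 = 0 := by nlinarith [sq_nonneg p.1, sq_nonneg p.2]
    exact Prod.ext h1 h2
  refine ⟨⟨zElem p, evenElem (p.1 / (p.1 ^ 2 + p.2 ^ 2)) (-p.2 / (p.1 ^ 2 + p.2 ^ 2)), ?_, ?_⟩,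
    rfl⟩ <;>
  · rw [zElem, evenElem_mul, ← evenElem_one_zero]
    congr 1 <;> field_simp <;> ring

/-- The integer powers of an element; the negative ones are powers of its inverse. -/
def intPow (a : KahlerAlgebra) : ℤ → KahlerAlgebra
  | Int.ofNat n => a ^ n
  | Int.negSucc n => Ring.inverse a ^ (n + 1)

/-! ### One-forms, curves, enclosed points -/

/-- The differential 1-form `k dx + g dy`. -/
def oneForm (k g : Plane → ℝ) : Plane → Plane →L[ℝ] ℝ := fun p =>
  k p • ContinuousLinearMap.fst ℝ ℝ ℝ + g p • ContinuousLinearMap.snd ℝ ℝ ℝ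

/-- The even function `w = k - g dxdy` attached to the 1-form `k dx + g dy`. -/
def wFun (k g : Plane → ℝ) : Plane → KahlerAlgebra := fun p => evenElem (k p) (-g p)

/-- `k dx + g dy = w dx`. -/
theorem covector_eq_wFun_mul_dx (k g : Plane → ℝ) (p : Plane) :
    covector (k p) (g p) = wFun k g p * dx := by
  rw [covector_eq, wFun, evenElem, add_mul, smul_mul_assoc, dxdy_mul_dx,
    Algebra.algebraMap_eq_smul_one, smul_mul_assoc, one_mul]
  simp

/-- `k dx + g dy` is differentiable and closed at every point of `U`: `∂k/∂y = ∂g/∂x`. -/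
def ClosedOn (k g : Plane → ℝ) (U : Set Plane) : Prop :=
  ∀ p ∈ U, DifferentiableAt ℝ k p ∧ DifferentiableAt ℝ g p ∧
    fderiv ℝ k p (0, 1) = fderiv ℝ g p (1, 0)

/-- The coefficient `j` in `k dx + g dy = h dρ + j dφ`, where `(ρ, φ)` are the polar coordinates
centred at `q`: the value of the 1-form on `∂/∂φ = -(y - y₀) ∂/∂x + (x - x₀) ∂/∂y`. -/
def angularCoeff (k g : Plane → ℝ) (q p : Plane) : ℝ :=
  oneForm k g p (-(p.2 - q.2), p.1 - q.1)

/-- The form `dφ = ((x - x₀) dy - (y - y₀) dx) / ρ ^ 2` of the polar coordinates centred at `q`. -/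
def angleForm (q : Plane) : Plane → Plane →L[ℝ] ℝ :=
  oneForm (fun p => -(p.2 - q.2) / ((p.1 - q.1) ^ 2 + (p.2 - q.2) ^ 2))
    (fun p => (p.1 - q.1) / ((p.1 - q.1) ^ 2 + (p.2 - q.2) ^ 2))

/-- The path is piecewise continuously differentiable. -/
def PiecewiseC1 {a b : Plane} (γ : Path a b) : Prop :=
  ∃ (n : ℕ) (t : ℕ → ℝ), Monotone t ∧ t 0 = 0 ∧ t n = 1 ∧
    ∀ i < n, ContDiffOn ℝ 1 γ.extend (Icc (t i) (t (i + 1)))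

/-- The number of turns of the closed curve `γ` around `q`, counted counterclockwise. -/
def windingNumber {a : Plane} (γ : Path a a) (q : Plane) : ℝ :=
  (2 * Real.pi)⁻¹ * curveIntegral (angleForm q) γ

/-- The points enclosed by the closed curve `γ`: those off the curve that lie in a bounded
connected component of its complement. -/
def enclosed {a : Plane} (γ : Path a a) : Set Plane :=
  {q | q ∉ range γ ∧ Bornology.IsBounded (connectedComponentIn (range γ)ᶜ q)}

/-! ### Integer power series, poles, constant terms -/

/-- Near `q` (but not necessarily at `q`), the function `F` is the sum of the series
`∑ b n (z - z₀) ^ n` over all integers `n`, whose coefficients lie in the even subalgebra. -/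
def IsIntegerSeries (F : Plane → KahlerAlgebra) (q : Plane) (b : ℤ → KahlerAlgebra) : Prop :=
  (∀ n, b n ∈ CliffordAlgebra.even (CliffordAlgebraQuaternion.Q (1 : ℝ) (1 : ℝ))) ∧
    ∀ᶠ p in 𝓝[≠] q, HasSum (fun n : ℤ => b n * intPow (zElem (p - q)) n) (F p)

/-- `F` is an integer power series in `z - z₀` near `q`, and its constant term is `c`. -/
def IsConstantTerm (F : Plane → KahlerAlgebra) (q : Plane) (c : KahlerAlgebra) : Prop :=
  (∃ b, IsIntegerSeries F q b) ∧ ∀ b, IsIntegerSeries F q b → b 0 = c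

/-- The function `(z - z₀) F`. -/
def zMul (q : Plane) (F : Plane → KahlerAlgebra) : Plane → KahlerAlgebra := fun p =>
  zElem (p - q) * F p

/-- `F` has a pole of order `m` at `q`: `m` is the smallest positive integer such that
`(z - z₀) ^ m F` tends to a nonzero limit as `z → z₀`; and `a` is that limit. -/
structure HasPole (F : Plane → KahlerAlgebra) (q : Plane) (m : ℕ) (a : KahlerAlgebra) : Prop where
  one_le : 1 ≤ m
  ne_zero : a ≠ 0
  tendsto : Tendsto (fun p => zElem (p - q) ^ m * F p) (𝓝[≠] q) (𝓝 a)
  smallest : ∀ n : ℕ, 1 ≤ n → n < m →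
    ¬ ∃ b ≠ 0, Tendsto (fun p => zElem (p - q) ^ n * F p) (𝓝[≠] q) (𝓝 b)

/-- The function `F - a / (z - z₀) ^ m`. -/
def subtractPole (F : Plane → KahlerAlgebra) (q : Plane) (m : ℕ) (a : KahlerAlgebra) :
    Plane → KahlerAlgebra := fun p =>
  F p - a * intPow (zElem (p - q)) (-(m : ℤ))

/-- `SuccessiveSubtraction q N F c`: starting from `F`, which has at `q` no pole or a pole of order
at most `N`, the procedure of successive subtraction ends with the value `c`. If there is no pole
left, the value is `0`; at a simple pole it is the limit `a` of `(z - z₀) F`; at a pole of order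
`m ≥ 2` one goes on with `F - a / (z - z₀) ^ m`, whose order must not exceed `m - 1`. -/
inductive SuccessiveSubtraction (q : Plane) :
    ℕ → (Plane → KahlerAlgebra) → KahlerAlgebra → Prop
  | noPole {N : ℕ} {F : Plane → KahlerAlgebra} {l : KahlerAlgebra}
      (hF : Tendsto F (𝓝[≠] q) (𝓝 l)) : SuccessiveSubtraction q N F 0
  | simplePole {N : ℕ} {F : Plane → KahlerAlgebra} {a : KahlerAlgebra}
      (hN : 1 ≤ N) (hF : HasPole F q 1 a) : SuccessiveSubtraction q N F a
  | subtract {N m : ℕ} {F : Plane → KahlerAlgebra} {a c : KahlerAlgebra}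
      (hm : 2 ≤ m) (hN : m ≤ N) (hF : HasPole F q m a)
      (hc : SuccessiveSubtraction q (m - 1) (subtractPole F q m a) c) :
      SuccessiveSubtraction q N F c

end KahlerPlane

end

open KahlerPlane

noncomputable section

namespace KahlerPlane

open MeasureTheory

section Curves

open intervalIntegral unitInterval

/-! ### Piecewise `C¹` paths -/

/-! The even subalgebra is a copy of ℂ in which `dxdy` plays the role of i (`toK`). Under it w
becomes f = k - g i, the form is α = Re(f dz), integer series become Laurent series with
coefficients β n, `areaPart` becomes the imaginary part, and the constant term of (z - z₀) w is the
residue β (-1).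

Near a singularity, f = E + c / (z - z₀) + H(1 / (z - z₀)) / (z - z₀)² with c = β (-1), E
holomorphic and H entire (`IsLaurent.exists_decomposition`). The last two terms are defined on the
whole plane without the singular point. The H-term is exact, and Re(c dz / (z - z₀)) = Re c · d log
ρ' - Im c · dφ', so together they integrate to -2π Im c times the winding number
(`PiecewiseC1.curveIntegral_singularPart`). Subtracting the finitely many singular parts leaves a
closed form on a neighbourhood of the curve and of its enclosed points, whose integral must be shown
to vanish.

This Cauchy theorem (`PiecewiseC1.curveIntegral_eq_zero_of_isClosedAt`) concerns a form ω that is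
merely differentiable and a curve that may cross itself. Let K be the curve with its enclosed
points, and η = χ ω with a cutoff χ equal to 1 near K. Green's theorem on parallelograms, averaged
over the direction of one side, shows that up to an exact form η is an average of the angle forms
centred at q, with weight curl η(q) / 2π. By Fubini, ∮ η = ∫ curl η(q) · n(γ, q) dq. The integrand
is zero: curl η = dχ ∧ ω vanishes on K, and the winding number vanishes off K.

The claims on constant terms and poles rest on `IsLaurent.integral_circle`: the constant coefficient
is a circle mean. It is therefore unique, and equals the limit of the function when there is one.
Subtracting a / (z - z₀)^m with m ≥ 2 does not change β (-1), so the procedure ends with the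
residue. -/

theorem Path.extend_mem_range {X : Type*} [TopologicalSpace X] {a b : X} (γ : Path a b) (t : ℝ) :
    γ.extend t ∈ range γ := by
  rw [← γ.extend_range]; exact mem_range_self t

section PiecewiseC1

variable {F : Type*} [NormedAddCommGroup F] [NormedSpace ℝ F]
  {a b : Plane} {γ : Path a b}

theorem derivWithin_extend_eq_of_mem_Ioo {u v : ℝ} (hu : 0 ≤ u) (hv : v ≤ 1) {t : ℝ}
    (ht : t ∈ Ioo u v) :
    derivWithin γ.extend (Icc 0 1) t = derivWithin γ.extend (Icc u v) t := by
  rw [derivWithin_of_mem_nhds (Icc_mem_nhds (hu.trans_lt ht.1) (ht.2.trans_le hv)),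
    derivWithin_of_mem_nhds (Icc_mem_nhds ht.1 ht.2)]

/-- On the open piece the integrand coincides with a function continuous on the closed piece. Only
the endpoints, where the one-sided derivatives of adjacent pieces may differ, are lost, and they
have measure zero. -/
theorem intervalIntegrable_curveIntegralFun {ω : Plane → Plane →L[ℝ] F}
    (hω : ContinuousOn ω (range γ)) {u v : ℝ} (hu : 0 ≤ u) (huv : u ≤ v) (hv : v ≤ 1)
    (hγ : ContDiffOn ℝ 1 γ.extend (Icc u v)) :
    IntervalIntegrable (curveIntegralFun ω γ) volume u v := by
  rcases huv.eq_or_lt with rfl | huv'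
  · exact IntervalIntegrable.refl
  have hc : ContinuousOn (fun t => ω (γ.extend t) (derivWithin γ.extend (Icc u v) t))
      (Icc u v) := by
    refine ContinuousOn.clm_apply ?_
      (hγ.continuousOn_derivWithin (uniqueDiffOn_Icc huv') le_rfl)
    exact hω.comp γ.continuous_extend.continuousOn fun t _ => Path.extend_mem_range γ t
  refine (hc.intervalIntegrable_of_Icc huv).congr_ae ?_
  rw [uIoc_of_le huv, ← restrict_Ioo_eq_restrict_Ioc]
  filter_upwards [ae_restrict_mem measurableSet_Ioo] with t ht
  rw [curveIntegralFun_def, derivWithin_extend_eq_of_mem_Ioo hu hv ht]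

theorem PiecewiseC1.exists_partition (hγ : PiecewiseC1 γ) :
    ∃ (n : ℕ) (t : ℕ → ℝ), Monotone t ∧ t 0 = 0 ∧ t n = 1 ∧ ∀ i < n, 0 ≤ t i ∧ t i ≤ t (i + 1) ∧
      t (i + 1) ≤ 1 ∧ ContDiffOn ℝ 1 γ.extend (Icc (t i) (t (i + 1))) := by
  obtain ⟨n, t, ht, h0, h1, h⟩ := hγ
  exact ⟨n, t, ht, h0, h1, fun i hi => ⟨h0 ▸ ht (Nat.zero_le i), ht (Nat.le_succ i),
    h1 ▸ ht (Nat.succ_le_of_lt hi), h i hi⟩⟩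

theorem PiecewiseC1.curveIntegrable (hγ : PiecewiseC1 γ) {ω : Plane → Plane →L[ℝ] F}
    (hω : ContinuousOn ω (range γ)) : CurveIntegrable ω γ := by
  obtain ⟨n, t, -, h0, h1, h⟩ := hγ.exists_partition
  rw [CurveIntegrable, ← h0, ← h1]
  refine IntervalIntegrable.trans_iterate fun i hi => ?_
  obtain ⟨hu, huv, hv, hd⟩ := h i hi
  exact intervalIntegrable_curveIntegralFun hω hu huv hv hd

theorem PiecewiseC1.integrable_derivWithin (hγ : PiecewiseC1 γ) :
    IntervalIntegrable (derivWithin γ.extend (Icc 0 1)) volume 0 1 := by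
  -- The derivative is itself the integrand of a vector-valued form, the constant one equal to the
  -- identity.
  have := hγ.curveIntegrable (ω := fun _ => ContinuousLinearMap.id ℝ Plane) continuousOn_const
  refine this.congr_ae (Eventually.of_forall fun t => ?_)
  simp [curveIntegralFun_def]

/-- The fundamental theorem of calculus along a piecewise `C¹` path. -/
theorem PiecewiseC1.curveIntegral_eq_sub [CompleteSpace F] (hγ : PiecewiseC1 γ)
    {ω : Plane → Plane →L[ℝ] F} {f : Plane → F} (hω : ContinuousOn ω (range γ))
    (hf : ∀ p ∈ range γ, HasFDerivAt f (ω p) p) :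
    curveIntegral ω γ = f b - f a := by
  obtain ⟨n, t, -, h0, h1, h⟩ := hγ.exists_partition
  have hint : ∀ i < n, IntervalIntegrable (curveIntegralFun ω γ) volume (t i) (t (i + 1)) := by
    intro i hi
    obtain ⟨hu, huv, hv, hd⟩ := h i hi
    exact intervalIntegrable_curveIntegralFun hω hu huv hv hd
  have hpiece : ∀ i < n, ∫ s in t i..t (i + 1), curveIntegralFun ω γ s =
      f (γ.extend (t (i + 1))) - f (γ.extend (t i)) := by
    intro i hi
    obtain ⟨hu, huv, hv, hd⟩ := h i hi
    refine integral_eq_sub_of_hasDerivAt_of_le (f := fun s => f (γ.extend s)) huv ?_ ?_ (hint i hi)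
    · intro s _
      exact ((hf _ (Path.extend_mem_range γ s)).continuousAt.comp
        γ.continuous_extend.continuousAt).continuousWithinAt
    · intro s hs
      have hd' : DifferentiableAt ℝ γ.extend s :=
        ((hd.differentiableOn one_ne_zero) s (Ioo_subset_Icc_self hs)).differentiableAt
          (Icc_mem_nhds hs.1 hs.2)
      rw [curveIntegralFun_def,
        derivWithin_of_mem_nhds (Icc_mem_nhds (hu.trans_lt hs.1) (hs.2.trans_le hv))]
      exact (hf _ (Path.extend_mem_range γ s)).comp_hasDerivAt s hd'.hasDerivAt
  rw [curveIntegral_def, ← h0, ← h1, ← sum_integral_adjacent_intervals hint,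
    Finset.sum_congr rfl fun i hi => hpiece i (Finset.mem_range.1 hi),
    Finset.sum_range_sub (fun i => f (γ.extend (t i)))]
  simp [h0, h1]

theorem PiecewiseC1.curveIntegral_eq_zero [CompleteSpace F] {γ : Path a a} (hγ : PiecewiseC1 γ)
    {ω : Plane → Plane →L[ℝ] F} {f : Plane → F} (hω : ContinuousOn ω (range γ))
    (hf : ∀ p ∈ range γ, HasFDerivAt f (ω p) p) : curveIntegral ω γ = 0 := by
  rw [hγ.curveIntegral_eq_sub hω hf, sub_self]

end PiecewiseC1

theorem curveIntegral_congr {a b : Plane} {γ : Path a b} {ω ω' : Plane → Plane →L[ℝ] ℝ}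
    (h : EqOn ω ω' (range γ)) : curveIntegral ω γ = curveIntegral ω' γ := by
  rw [curveIntegral_def, curveIntegral_def]
  refine intervalIntegral.integral_congr fun t _ => ?_
  simp only [curveIntegralFun_def, h (Path.extend_mem_range γ t)]

/-! ### Complex notation for 1-forms, winding numbers -/

/-- The point `(x, y)` of the plane as the complex number `x + y i`. -/
def toC : Plane →L[ℝ] ℂ := Complex.equivRealProdCLM.symm

@[simp] theorem toC_re (p : Plane) : (toC p).re = p.1 := by
  rfl

@[simp] theorem toC_im (p : Plane) : (toC p).im = p.2 := by
  rfl

theorem toC_injective : Function.Injective toC := Complex.equivRealProdCLM.symm.injective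

theorem toC_surjective : Function.Surjective toC := Complex.equivRealProdCLM.symm.surjective

/-- The real 1-form `Re (f dz)`. -/
def reForm (f : ℂ → ℂ) : Plane → Plane →L[ℝ] ℝ := fun p =>
  Complex.reCLM ∘L (f (toC p) • toC)

theorem reForm_apply (f : ℂ → ℂ) (p v : Plane) : reForm f p v = (f (toC p) * toC v).re := rfl

theorem hasFDerivAt_reForm_of_hasDerivAt {h f : ℂ → ℂ} {p : Plane}
    (hd : HasDerivAt h (f (toC p)) (toC p)) :
    HasFDerivAt (fun p => (h (toC p)).re) (reForm f p) p := by
  have h1 := (hd.hasFDerivAt.restrictScalars ℝ).comp p toC.hasFDerivAt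
  refine (Complex.reCLM.hasFDerivAt.comp p h1).congr_fderiv ?_
  ext <;> simp [reForm_apply, mul_comm]

/-- A 1-form is closed at `p` if it is differentiable there with symmetric derivative. -/
def IsClosedAt (ω : Plane → Plane →L[ℝ] ℝ) (p : Plane) : Prop :=
  DifferentiableAt ℝ ω p ∧ ∀ u v, fderiv ℝ ω p u v = fderiv ℝ ω p v u

theorem IsClosedAt.congr {ω ω' : Plane → Plane →L[ℝ] ℝ} {p : Plane} (h : IsClosedAt ω p)
    (he : ω' =ᶠ[𝓝 p] ω) : IsClosedAt ω' p :=
  ⟨h.1.congr_of_eventuallyEq he, fun u v => by rw [he.fderiv_eq]; exact h.2 u v⟩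

theorem IsClosedAt.sub {ω ω' : Plane → Plane →L[ℝ] ℝ} {p : Plane} (h : IsClosedAt ω p)
    (h' : IsClosedAt ω' p) : IsClosedAt (ω - ω') p :=
  ⟨h.1.sub h'.1, fun u v => by
    rw [fderiv_sub h.1 h'.1]; simp only [sub_apply, h.2 u v, h'.2 u v]⟩

/-- The derivative sends (u, v) to Re(f' u v), which is symmetric because ℂ is commutative. -/
theorem isClosedAt_reForm {f : ℂ → ℂ} {p : Plane} (hf : DifferentiableAt ℂ f (toC p)) :
    IsClosedAt (reForm f) p := by
  have h1 := (hf.hasDerivAt.hasFDerivAt.restrictScalars ℝ).comp p toC.hasFDerivAt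
  let L : ℂ →L[ℝ] (Plane →L[ℝ] ℝ) :=
    (ContinuousLinearMap.compL ℝ Plane ℂ ℝ Complex.reCLM) ∘L
      ((ContinuousLinearMap.lsmul ℝ ℂ : ℂ →L[ℝ] ((Plane →L[ℝ] ℂ)) →L[ℝ] (Plane →L[ℝ] ℂ)).flip toC)
  have h2 : HasFDerivAt (reForm f) _ p := L.hasFDerivAt.comp p h1
  refine ⟨h2.differentiableAt, fun u v => ?_⟩
  rw [h2.fderiv]
  simp [L]
  ring

theorem continuousAt_reForm {f : ℂ → ℂ} {p : Plane} (hf : ContinuousAt f (toC p)) :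
    ContinuousAt (reForm f) p := by
  have h1 : ContinuousAt (fun p => f (toC p)) p := hf.comp toC.continuous.continuousAt
  exact continuousAt_const.clm_comp (h1.smul continuousAt_const)

/-- dφ is the imaginary part of dz / (z - q), that is, the real part of -i dz / (z - q). -/
theorem angleForm_eq_reForm (q : Plane) :
    angleForm q = reForm fun z => -Complex.I / (z - toC q) := by
  funext p
  ext <;> simp [angleForm, oneForm, reForm_apply, Complex.div_re, Complex.div_im,
    Complex.normSq_apply] <;> ring

theorem toC_sub_ne_zero {p q : Plane} (h : p ≠ q) : toC p - toC q ≠ 0 :=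
  sub_ne_zero.2 (toC_injective.ne h)

theorem differentiableAt_angle {p q : Plane} (h : p ≠ q) :
    DifferentiableAt ℂ (fun z => -Complex.I / (z - toC q)) (toC p) := by
  have := toC_sub_ne_zero h
  fun_prop (disch := assumption)

theorem continuousOn_angleForm {q : Plane} {s : Set Plane} (hq : q ∉ s) :
    ContinuousOn (angleForm q) s := by
  intro p hp
  have hpq : p ≠ q := by rintro rfl; exact hq hp
  rw [angleForm_eq_reForm]
  exact (continuousAt_reForm (differentiableAt_angle hpq).continuousAt).continuousWithinAt

/-! ### Winding numbers and the compact set formed by a curve and its enclosed points -/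

section WindingNumber

variable {a : Plane} {γ : Path a a}

/-- A closed curve has winding number zero around a point that is farther from the origin than
every point of the curve. -/
theorem windingNumber_eq_zero_of_norm_lt (hγ : PiecewiseC1 γ) {q : Plane}
    (h : ∀ p ∈ range γ, ‖toC p‖ < ‖toC q‖) : windingNumber γ q = 0 := by
  have hq : q ∉ range γ := fun hq => lt_irrefl _ (h q hq)
  have hq0 : toC q ≠ 0 := fun h0 => by
    have := h a ⟨0, γ.source⟩
    simp only [h0, norm_zero] at this
    exact absurd this (norm_nonneg _).not_gt
  rw [windingNumber, hγ.curveIntegral_eq_zero (continuousOn_angleForm hq)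
    (f := fun p => (-Complex.I * Complex.log ((toC q - toC p) / toC q)).re), mul_zero]
  intro p hp
  rw [angleForm_eq_reForm]
  refine hasFDerivAt_reForm_of_hasDerivAt
    (h := fun z => -Complex.I * Complex.log ((toC q - z) / toC q)) ?_
  -- The quotient is 1 - p / q with |p / q| < 1, so it stays in the right half-plane, where the
  -- principal logarithm is holomorphic.
  have hs : (toC q - toC p) / toC q ∈ Complex.slitPlane := by
    refine Complex.mem_slitPlane_iff.2 (Or.inl ?_)
    rw [sub_div, div_self hq0, Complex.sub_re, Complex.one_re, sub_pos]
    refine (Complex.re_le_norm _).trans_lt ?_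
    rw [norm_div]
    exact (div_lt_one (norm_pos_iff.2 hq0)).2 (h p hp)
  have hne : toC q - toC p ≠ 0 := toC_sub_ne_zero fun h => hq (h ▸ hp)
  have hne' : toC p - toC q ≠ 0 := by rw [← neg_sub]; exact neg_ne_zero.2 hne
  have h1 : HasDerivAt (fun z => (toC q - z) / toC q) (-1 / toC q) (toC p) :=
    ((hasDerivAt_id _).const_sub _).div_const _
  refine ((h1.clog hs).const_mul (-Complex.I)).congr_deriv ?_
  field_simp
  ring

/-- The winding number does not change along a segment that does not meet the curve. -/
theorem windingNumber_eq_of_segment (hγ : PiecewiseC1 γ) {q q' : Plane}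
    (h : ∀ p ∈ range γ, p ∉ segment ℝ q q') : windingNumber γ q = windingNumber γ q' := by
  have hq : q ∉ range γ := fun hq => h q hq (left_mem_segment ℝ q q')
  have hq' : q' ∉ range γ := fun hq => h q' hq (right_mem_segment ℝ q q')
  rw [windingNumber, windingNumber, ← sub_eq_zero, ← mul_sub, ← curveIntegral_sub
    (hγ.curveIntegrable (continuousOn_angleForm hq))
    (hγ.curveIntegrable (continuousOn_angleForm hq')),
    hγ.curveIntegral_eq_zero ((continuousOn_angleForm hq).sub (continuousOn_angleForm hq'))
    (f := fun p => (-Complex.I * Complex.log ((toC p - toC q) / (toC p - toC q'))).re), mul_zero]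
  intro p hp
  have hne : toC p - toC q ≠ 0 := toC_sub_ne_zero fun h => hq (h ▸ hp)
  have hne' : toC p - toC q' ≠ 0 := toC_sub_ne_zero fun h => hq' (h ▸ hp)
  have : (angleForm q - angleForm q') p =
      reForm (fun z => -Complex.I / (z - toC q) - -Complex.I / (z - toC q')) p := by
    rw [angleForm_eq_reForm, angleForm_eq_reForm]
    ext <;> simp only [Pi.sub_apply, sub_apply, reForm_apply, sub_mul,
      Complex.sub_re, ContinuousLinearMap.comp_apply]
  rw [this]
  refine hasFDerivAt_reForm_of_hasDerivAt
    (h := fun z => -Complex.I * Complex.log ((z - toC q) / (z - toC q'))) ?_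
  -- The quotient is real and nonpositive only if p lies on the segment from q to q', so off the
  -- segment one branch of the logarithm suffices.
  have hs : (toC p - toC q) / (toC p - toC q') ∈ Complex.slitPlane := by
    by_contra hs
    rw [Complex.mem_slitPlane_iff, not_or, not_lt, not_not] at hs
    obtain ⟨hre, him⟩ := hs
    set c := (toC p - toC q) / (toC p - toC q') with hc
    have hcr : c = (c.re : ℂ) := Complex.ext rfl (by simpa using him)
    have hmul : toC p - toC q = c.re * (toC p - toC q') := by
      rw [← hcr, hc, div_mul_cancel₀ _ hne']
    have hpos : 0 < 1 - c.re := by linarith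
    -- Solving p - q = c (p - q') gives p = (q - c q') / (1 - c), a convex combination since c ≤ 0.
    refine h p hp ⟨1 / (1 - c.re), -c.re / (1 - c.re), by positivity,
      div_nonneg (by linarith) hpos.le, by field_simp; ring, ?_⟩
    have e1 := congrArg Complex.re hmul
    have e2 := congrArg Complex.im hmul
    simp at e1 e2
    ext
    · simp only [Prod.fst_add, Prod.smul_fst, smul_eq_mul]
      field_simp; linarith
    · simp only [Prod.snd_add, Prod.smul_snd, smul_eq_mul]
      field_simp; linarith
  have h1 : HasDerivAt (fun z => (z - toC q) / (z - toC q'))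
      ((1 * (toC p - toC q') - (toC p - toC q) * 1) / (toC p - toC q') ^ 2) (toC p) :=
    ((hasDerivAt_id _).sub_const _).div ((hasDerivAt_id _).sub_const _) hne'
  refine ((h1.clog hs).const_mul (-Complex.I)).congr_deriv ?_
  field_simp
  ring

theorem isClosed_range_path : IsClosed (range γ) := (isCompact_range γ.continuous).isClosed

/-- The winding number is locally constant off the curve, hence constant on the component of q. That
component is unbounded, so it reaches points farther from the origin than the whole curve. -/
theorem windingNumber_eq_zero_of_notMem_enclosed (hγ : PiecewiseC1 γ) {q : Plane}
    (hq : q ∉ range γ) (hq' : q ∉ enclosed γ) : windingNumber γ q = 0 := by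
  set C := connectedComponentIn (range γ)ᶜ q with hC
  have hopen : IsOpen (range γ)ᶜ := isClosed_range_path.isOpen_compl
  have hCo : IsOpen C := hopen.connectedComponentIn
  have hCs : C ⊆ (range γ)ᶜ := connectedComponentIn_subset _ _
  have hunb : ¬ Bornology.IsBounded C := fun h => hq' ⟨hq, h⟩
  obtain ⟨R, hR⟩ := (isCompact_range (toC.continuous.comp γ.continuous)).isBounded.exists_norm_le
  -- Distance is measured by the Euclidean norm of ℂ, whereas `Plane` carries the sup norm;
  -- boundedness passes between them by the Lipschitz equivalence.
  obtain ⟨q', hq'C, hq'R⟩ : ∃ q' ∈ C, R < ‖toC q'‖ := by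
    by_contra! hcon
    refine hunb ?_
    have hb : Bornology.IsBounded (toC '' C) :=
      isBounded_iff_forall_norm_le.2 ⟨R, by rintro _ ⟨x, hx, rfl⟩; exact hcon x hx⟩
    have := Complex.equivRealProdCLM.lipschitz.isBounded_image hb
    rw [← image_comp] at this
    simpa [toC, Function.comp_def] using this
  have h0 : windingNumber γ q' = 0 := by
    refine windingNumber_eq_zero_of_norm_lt hγ ?_
    rintro _ ⟨t, rfl⟩
    exact (hR _ ⟨t, rfl⟩).trans_lt hq'R
  rw [← h0]
  refine isPreconnected_connectedComponentIn.induction₂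
    (fun x y => windingNumber γ x = windingNumber γ y) ?_ (fun _ _ _ _ _ _ => Eq.trans)
    (fun _ _ _ _ => Eq.symm) (mem_connectedComponentIn hq) hq'C
  intro x hx
  obtain ⟨ε, hε, hball⟩ := Metric.isOpen_iff.1 hCo x hx
  filter_upwards [mem_nhdsWithin_of_mem_nhds (Metric.ball_mem_nhds x hε)] with y hy
  refine windingNumber_eq_of_segment hγ fun p hp hseg => hCs (hball ?_) hp
  exact (convex_ball x ε).segment_subset (Metric.mem_ball_self hε) hy hseg

/-- The complement is a union of unbounded components of an open set, hence open. The set is bounded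
because a point farther out than the curve escapes to infinity along its radial ray. -/
theorem isCompact_range_union_enclosed : IsCompact (range γ ∪ enclosed γ) := by
  have hopen : IsOpen (range γ)ᶜ := isClosed_range_path.isOpen_compl
  refine Metric.isCompact_of_isClosed_isBounded ?_ ?_
  · rw [← isOpen_compl_iff, isOpen_iff_mem_nhds]
    intro q hq
    rw [mem_compl_iff, mem_union, not_or] at hq
    refine mem_of_superset (hopen.connectedComponentIn.mem_nhds (mem_connectedComponentIn hq.1)) ?_
    intro q' hq'
    rw [mem_compl_iff, mem_union, not_or]
    refine ⟨connectedComponentIn_subset _ _ hq', fun h => hq.2 ⟨hq.1, ?_⟩⟩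
    rw [connectedComponentIn_eq hq']
    exact h.2
  · obtain ⟨R, hR⟩ := (isCompact_range γ.continuous).isBounded.exists_norm_le
    refine isBounded_iff_forall_norm_le.2 ⟨R, ?_⟩
    rintro q (hq | hq)
    · exact hR q hq
    · by_contra! hlt
      have hR0 : 0 ≤ R := (norm_nonneg _).trans (hR a ⟨0, γ.source⟩)
      have hq0 : 0 < ‖q‖ := hR0.trans_lt hlt
      have hray : (fun s : ℝ => s • q) '' Ici 1 ⊆ connectedComponentIn (range γ)ᶜ q := by
        refine IsPreconnected.subset_connectedComponentIn
          (isPreconnected_Ici.image _ (by fun_prop)) ⟨1, by simp, by simp⟩ ?_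
        rintro _ ⟨s, hs, rfl⟩ hmem
        have := hR _ hmem
        rw [norm_smul, Real.norm_of_nonneg (zero_le_one.trans hs)] at this
        nlinarith [mem_Ici.1 hs]
      obtain ⟨M, hM⟩ := (hq.2.subset hray).exists_norm_le
      have := hM _ ⟨max 1 ((|M| + 1) / ‖q‖), mem_Ici.2 (le_max_left _ _), rfl⟩
      simp only [norm_smul] at this
      rw [Real.norm_of_nonneg (zero_le_one.trans (le_max_left _ _))] at this
      have h2 : (|M| + 1) / ‖q‖ * ‖q‖ ≤ max 1 ((|M| + 1) / ‖q‖) * ‖q‖ :=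
        mul_le_mul_of_nonneg_right (le_max_right _ _) hq0.le
      rw [div_mul_cancel₀ _ hq0.ne'] at h2
      linarith [le_abs_self M]

end WindingNumber

/-! ### Cauchy's theorem for closed 1-forms -/

/-- The curl `∂g/∂x - ∂k/∂y` of the 1-form `k dx + g dy`. -/
def curl (η : Plane → Plane →L[ℝ] ℝ) (p : Plane) : ℝ :=
  fderiv ℝ η p (1, 0) (0, 1) - fderiv ℝ η p (0, 1) (1, 0)

/-- An alternating bilinear form on the plane is a multiple of the determinant. -/
theorem fderiv_sub_fderiv_swap (η : Plane → Plane →L[ℝ] ℝ) (p u v : Plane) :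
    fderiv ℝ η p u v - fderiv ℝ η p v u = curl η p * (u.1 * v.2 - u.2 * v.1) := by
  have h : ∀ w : Plane, w = w.1 • ((1, 0) : Plane) + w.2 • ((0, 1) : Plane) := fun w => by
    ext <;> simp
  conv_lhs => rw [h u, h v]
  simp only [map_add, map_smul, add_apply, smul_apply, smul_eq_mul, curl]
  ring

theorem curl_eq_zero_of_notMem_tsupport {η : Plane → Plane →L[ℝ] ℝ} {p : Plane}
    (h : p ∉ tsupport η) : curl η p = 0 := by
  have := notMem_tsupport_iff_eventuallyEq.1 h
  rw [curl, this.fderiv_eq]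
  simp

/-- Green's theorem on the parallelogram with vertex `p` and sides `e`, `R • w`. -/
theorem integral_parallelogram {η : Plane → Plane →L[ℝ] ℝ} (hη : Differentiable ℝ η)
    (hc : Continuous (curl η)) (p e w : Plane) (R : ℝ) :
    ∫ s in (0 : ℝ)..1, ∫ r in (0 : ℝ)..R,
        curl η (p + s • e + r • w) * (e.1 * w.2 - e.2 * w.1) =
      (∫ r in (0 : ℝ)..R, η (p + e + r • w) w) - (∫ r in (0 : ℝ)..R, η (p + r • w) w) -
        (∫ s in (0 : ℝ)..1, η (p + s • e + R • w) e) + ∫ s in (0 : ℝ)..1, η (p + s • e) e := by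
  let A : ℝ × ℝ → Plane := fun x => p + x.1 • e + x.2 • w
  let A' : ℝ × ℝ →L[ℝ] Plane :=
    (ContinuousLinearMap.fst ℝ ℝ ℝ).smulRight e + (ContinuousLinearMap.snd ℝ ℝ ℝ).smulRight w
  have hA : ∀ x, HasFDerivAt A A' x := fun x =>
    ((hasFDerivAt_fst.smul_const e).const_add p).add (hasFDerivAt_snd.smul_const w)
  have hcomp : ∀ (v : Plane) x, HasFDerivAt (fun x => η (A x) v)
      ((ContinuousLinearMap.apply ℝ ℝ v) ∘L (fderiv ℝ η (A x) ∘L A')) x := fun v x =>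
    (ContinuousLinearMap.apply ℝ ℝ v).hasFDerivAt.comp x ((hη (A x)).hasFDerivAt.comp x (hA x))
  have hAc : Continuous A := by fun_prop
  have hdiv : ∀ x : ℝ × ℝ, ((ContinuousLinearMap.apply ℝ ℝ w) ∘L (fderiv ℝ η (A x) ∘L A')) (1, 0) +
      (-((ContinuousLinearMap.apply ℝ ℝ e) ∘L (fderiv ℝ η (A x) ∘L A'))) (0, 1) =
      curl η (A x) * (e.1 * w.2 - e.2 * w.1) := fun x => by
    rw [← fderiv_sub_fderiv_swap]
    simp [A', sub_eq_add_neg]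
  -- This divergence theorem asks for a derivative at each point and for integrability of the
  -- divergence alone, here a multiple of `curl η`. The partial derivatives of η need not be
  -- continuous.
  have key := integral2_divergence_prod_of_hasFDerivAt (fun x => η (A x) w) (fun x => -η (A x) e)
    (fun x => (ContinuousLinearMap.apply ℝ ℝ w) ∘L (fderiv ℝ η (A x) ∘L A'))
    (fun x => -((ContinuousLinearMap.apply ℝ ℝ e) ∘L (fderiv ℝ η (A x) ∘L A'))) 0 0 1 R
    (fun x _ => (hcomp w x).continuousAt.continuousWithinAt)
    (fun x _ => (hcomp e x).neg.continuousAt.continuousWithinAt)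
    (fun x _ => hcomp w x) (fun x _ => (hcomp e x).neg) ?_
  · simp only [hdiv] at key
    simp only [A, intervalIntegral.integral_neg, one_smul, zero_smul, add_zero] at key
    rw [key]
    ring
  · simp only [hdiv]
    exact ((hc.comp hAc).mul continuous_const).continuousOn.integrableOn_compact
      (isCompact_uIcc.prod isCompact_uIcc)

/-- The unit vector in the direction `θ`. -/
def unitDir (θ : ℝ) : Plane := (Real.cos θ, Real.sin θ)

@[fun_prop]
theorem continuous_unitDir : Continuous unitDir := by unfold unitDir; fun_prop

/-- The norm is the sup norm, so a unit direction has norm possibly below 1; 1/2 is a crude lower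
bound. -/
theorem half_le_norm_unitDir (θ : ℝ) : 1 / 2 ≤ ‖unitDir θ‖ := by
  by_contra! h
  have h1 := (norm_fst_le (unitDir θ)).trans_lt h
  have h2 := (norm_snd_le (unitDir θ)).trans_lt h
  simp only [unitDir, Real.norm_eq_abs] at h1 h2
  have := Real.sin_sq_add_cos_sq θ
  rw [← sq_abs, ← sq_abs (Real.cos θ)] at this
  nlinarith [abs_nonneg (Real.cos θ), abs_nonneg (Real.sin θ)]

/-- Origin of the factor 4: r / 2 - R ≥ R as soon as r ≥ 4R. Rays of that length started in the ball
of radius R end outside the open ball. -/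
theorem le_norm_add_smul_unitDir {p : Plane} {R r : ℝ} (hp : ‖p‖ ≤ R) (hr : 4 * R ≤ r) (θ : ℝ) :
    R ≤ ‖p + r • unitDir θ‖ := by
  have hr0 : 0 ≤ r := le_trans (by linarith [norm_nonneg p]) hr
  have h1 := norm_sub_norm_le (r • unitDir θ) (-p)
  rw [norm_neg, sub_neg_eq_add, add_comm, norm_smul, Real.norm_of_nonneg hr0] at h1
  nlinarith [half_le_norm_unitDir θ]

/-- The mean over all directions of the integrals of `η` along the rays that start at `p`. -/
def rayPotential (η : Plane → Plane →L[ℝ] ℝ) (R : ℝ) (p : Plane) : ℝ :=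
  -(2 * Real.pi)⁻¹ * ∫ θ in -Real.pi..Real.pi, ∫ r in (0 : ℝ)..R, η (p + r • unitDir θ) (unitDir θ)

/-- The angular part of a compactly supported 1-form, an average of angle forms with weight `m`. -/
def rayForm (m : Plane → ℝ) (R : ℝ) : Plane → Plane →L[ℝ] ℝ :=
  oneForm
    (fun p => (2 * Real.pi)⁻¹ *
      ∫ θ in -Real.pi..Real.pi, ∫ r in (0 : ℝ)..R, m (p + r • unitDir θ) * Real.sin θ)
    (fun p => (2 * Real.pi)⁻¹ *
      ∫ θ in -Real.pi..Real.pi, ∫ r in (0 : ℝ)..R, m (p + r • unitDir θ) * -Real.cos θ)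

theorem continuous_rayForm {m : Plane → ℝ} (hm : Continuous m) (R : ℝ) :
    Continuous (rayForm m R) := by
  unfold rayForm oneForm
  fun_prop

theorem rayForm_apply {m : Plane → ℝ} (hm : Continuous m) (R : ℝ) (p e : Plane) :
    rayForm m R p e = (2 * Real.pi)⁻¹ * ∫ θ in -Real.pi..Real.pi, ∫ r in (0 : ℝ)..R,
      m (p + r • unitDir θ) * (e.1 * (unitDir θ).2 - e.2 * (unitDir θ).1) := by
  have h : ∀ θ, ∫ r in (0 : ℝ)..R,
      m (p + r • unitDir θ) * (e.1 * (unitDir θ).2 - e.2 * (unitDir θ).1) =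
      (∫ r in (0 : ℝ)..R, m (p + r • unitDir θ) * Real.sin θ) * e.1 +
      (∫ r in (0 : ℝ)..R, m (p + r • unitDir θ) * -Real.cos θ) * e.2 := fun θ => by
    rw [← intervalIntegral.integral_mul_const, ← intervalIntegral.integral_mul_const,
      ← intervalIntegral.integral_add]
    · refine integral_congr fun r _ => ?_
      simp only [unitDir]
      ring
    · exact Continuous.intervalIntegrable (by fun_prop) _ _
    · exact Continuous.intervalIntegrable (by fun_prop) _ _
  simp only [h]
  rw [intervalIntegral.integral_add, intervalIntegral.integral_mul_const,
    intervalIntegral.integral_mul_const]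
  · simp only [rayForm, oneForm, add_apply, smul_apply,
      ContinuousLinearMap.coe_fst', ContinuousLinearMap.coe_snd', smul_eq_mul]
    ring
  · exact Continuous.intervalIntegrable (by fun_prop) _ _
  · exact Continuous.intervalIntegrable (by fun_prop) _ _

theorem intervalIntegral_swap_of_continuous {F : ℝ → ℝ → ℝ} (hF : Continuous F.uncurry)
    (a b c d : ℝ) : ∫ x in a..b, ∫ y in c..d, F x y = ∫ y in c..d, ∫ x in a..b, F x y :=
  intervalIntegral_intervalIntegral_swap
    ((hF.continuousOn.integrableOn_compact (isCompact_uIcc.prod isCompact_uIcc)).mono_set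
      (prod_mono uIoc_subset_uIcc uIoc_subset_uIcc))

/-! ### A compactly supported form is exact up to its angular part -/

section Decomposition

variable {η : Plane → Plane →L[ℝ] ℝ} {R : ℝ}

/-- Green's theorem on the parallelogram with sides e and 4R times a unit vector, averaged over all
directions. The two sides along the rays give the increment of the potential, the side e gives the
integral of η, and the area term gives `rayForm`. -/
theorem rayPotential_add_sub (hη : Differentiable ℝ η) (hc : Continuous (curl η))
    (hs : tsupport η ⊆ Metric.ball 0 R) {p e : Plane} (hp : ‖p‖ ≤ R) (hpe : ‖p + e‖ ≤ R) :
    rayPotential η (4 * R) (p + e) - rayPotential η (4 * R) p =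
      ∫ s in (0 : ℝ)..1, (η (p + s • e) e - rayForm (curl η) (4 * R) (p + s • e) e) := by
  have hηc : Continuous η := hη.continuous
  -- The side opposite to e lies outside the support of η.
  have hfar : ∀ θ, ∫ s in (0 : ℝ)..1, η (p + s • e + (4 * R) • unitDir θ) e = 0 := fun θ => by
    rw [intervalIntegral.integral_congr (g := fun _ => 0), intervalIntegral.integral_zero]
    intro s hs'
    rw [uIcc_of_le zero_le_one] at hs'
    have hball : ‖p + s • e‖ ≤ R := by
      have : p + s • e ∈ Metric.closedBall (0 : Plane) R := by
        refine (convex_closedBall (0 : Plane) R).add_smul_mem ?_ ?_ hs' <;> simpa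
      simpa using this
    have hR := le_norm_add_smul_unitDir hball le_rfl θ
    have : η (p + s • e + (4 * R) • unitDir θ) = 0 := by
      by_contra hne
      have := hs (subset_tsupport _ hne)
      rw [mem_ball_zero_iff] at this
      linarith
    simp [this]
  have hpar := fun θ => integral_parallelogram hη hc p e (unitDir θ) (4 * R)
  simp only [hfar, sub_zero] at hpar
  have hJ : ∫ θ in -Real.pi..Real.pi, (∫ s in (0 : ℝ)..1, ∫ r in (0 : ℝ)..(4 * R),
        curl η (p + s • e + r • unitDir θ) * (e.1 * (unitDir θ).2 - e.2 * (unitDir θ).1)) =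
      (∫ θ in -Real.pi..Real.pi, ∫ r in (0 : ℝ)..(4 * R), η (p + e + r • unitDir θ) (unitDir θ)) -
      (∫ θ in -Real.pi..Real.pi, ∫ r in (0 : ℝ)..(4 * R), η (p + r • unitDir θ) (unitDir θ)) +
      2 * Real.pi * ∫ s in (0 : ℝ)..1, η (p + s • e) e := by
    simp only [hpar]
    rw [intervalIntegral.integral_add, intervalIntegral.integral_sub,
      intervalIntegral.integral_const, smul_eq_mul]
    · ring
    all_goals exact Continuous.intervalIntegrable (by fun_prop) _ _
  rw [intervalIntegral_swap_of_continuous (by simp only [Function.uncurry_def]; fun_prop)] at hJ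
  have hpi : (2 * Real.pi) ≠ 0 := by positivity
  have hN : ∀ s : ℝ, ∫ θ in -Real.pi..Real.pi, ∫ r in (0 : ℝ)..(4 * R),
        curl η (p + s • e + r • unitDir θ) * (e.1 * (unitDir θ).2 - e.2 * (unitDir θ).1) =
      2 * Real.pi * rayForm (curl η) (4 * R) (p + s • e) e := fun s => by
    rw [rayForm_apply hc, mul_inv_cancel_left₀ hpi]
  have hNc := continuous_rayForm hc (4 * R)
  simp only [hN, intervalIntegral.integral_const_mul] at hJ
  rw [intervalIntegral.integral_sub, rayPotential, rayPotential, ← mul_right_inj' hpi]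
  · field_simp
    linarith
  all_goals exact Continuous.intervalIntegrable (by fun_prop) _ _

/-- Increments of the potential are segment integrals of a continuous form, so that form is the
derivative. -/
theorem hasFDerivAt_rayPotential (hη : Differentiable ℝ η) (hc : Continuous (curl η))
    (hs : tsupport η ⊆ Metric.ball 0 R) {p : Plane} (hp : ‖p‖ < R) :
    HasFDerivAt (rayPotential η (4 * R)) ((η - rayForm (curl η) (4 * R)) p) p := by
  have hcont : Continuous (η - rayForm (curl η) (4 * R)) :=
    hη.continuous.sub (continuous_rayForm hc _)
  have h := (HasFDerivAt.curveIntegral_segment_source (a := p) hcont).add_const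
    (rayPotential η (4 * R) p)
  refine h.congr_of_eventuallyEq ?_
  have hball : Metric.ball (0 : Plane) R ∈ 𝓝 p := Metric.isOpen_ball.mem_nhds (by simpa)
  filter_upwards [hball] with q hq
  rw [mem_ball_zero_iff] at hq
  have h1 := rayPotential_add_sub hη hc hs (p := p) (e := q - p) hp.le (by simpa using hq.le)
  rw [add_sub_cancel] at h1
  rw [← sub_eq_iff_eq_add, h1, curveIntegral_segment]
  refine integral_congr fun t _ => ?_
  simp only [AffineMap.lineMap_apply, vsub_eq_sub, vadd_eq_add, Pi.sub_apply,
    sub_apply, add_comm]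

theorem PiecewiseC1.curveIntegral_eq_curveIntegral_rayForm {a : Plane} {γ : Path a a}
    (hγ : PiecewiseC1 γ) (hη : Differentiable ℝ η) (hc : Continuous (curl η))
    (hs : tsupport η ⊆ Metric.ball 0 R) (hR : range γ ⊆ Metric.ball 0 R) :
    curveIntegral η γ = curveIntegral (rayForm (curl η) (4 * R)) γ := by
  have hN := continuous_rayForm hc (4 * R)
  rw [← sub_eq_zero, ← curveIntegral_sub (hγ.curveIntegrable hη.continuous.continuousOn)
    (hγ.curveIntegrable hN.continuousOn)]
  refine hγ.curveIntegral_eq_zero (hη.continuous.sub hN).continuousOn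
    (f := rayPotential η (4 * R)) fun p hp => ?_
  exact hasFDerivAt_rayPotential hη hc hs (by simpa using hR hp)

end Decomposition

/-! ### Ray averages as area integrals of angle forms -/

theorem setIntegral_polarCoord_target {F : ℝ × ℝ → ℝ} (hF : Continuous F) {R : ℝ} (hR : 0 ≤ R)
    (h0 : ∀ r θ, R ≤ r → F (r, θ) = 0) :
    ∫ x in polarCoord.target, F x = ∫ θ in -Real.pi..Real.pi, ∫ r in (0 : ℝ)..R, F (r, θ) := by
  have hpi : -Real.pi ≤ Real.pi := by linarith [Real.pi_pos]
  have hsub : Ioo (0 : ℝ) R ×ˢ Ioo (-Real.pi) Real.pi ⊆ polarCoord.target :=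
    prod_mono Ioo_subset_Ioi_self subset_rfl
  have hint : IntegrableOn F (Ioo (0 : ℝ) R ×ˢ Ioo (-Real.pi) Real.pi) :=
    (hF.continuousOn.integrableOn_compact (isCompact_Icc.prod isCompact_Icc)).mono_set
      (prod_mono Ioo_subset_Icc_self Ioo_subset_Icc_self)
  rw [setIntegral_eq_of_subset_of_forall_sdiff_eq_zero polarCoord.open_target.measurableSet hsub]
  · rw [Measure.volume_eq_prod, ← Measure.prod_restrict, integral_prod_symm]
    · rw [integral_of_le hpi, integral_Ioc_eq_integral_Ioo]
      refine integral_congr_ae (Eventually.of_forall fun θ => ?_)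
      simp only
      rw [integral_of_le hR, integral_Ioc_eq_integral_Ioo]
    · rw [Measure.prod_restrict, ← Measure.volume_eq_prod]
      exact hint
  · rintro ⟨r, θ⟩ ⟨⟨hr, hθ⟩, hn⟩
    exact h0 r θ (not_lt.1 fun h => hn ⟨⟨hr, h⟩, hθ⟩)

theorem angleForm_apply (q p e : Plane) : angleForm q p e =
    (-(p.2 - q.2) / ((p.1 - q.1) ^ 2 + (p.2 - q.2) ^ 2)) * e.1 +
      ((p.1 - q.1) / ((p.1 - q.1) ^ 2 + (p.2 - q.2) ^ 2)) * e.2 := by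
  simp [angleForm, oneForm]

/-- Polar coordinates q = p + r u centred at p: the factor r of the area element cancels the factor
1/r of the angle form. -/
theorem rayForm_eq_integral_angleForm {m : Plane → ℝ} (hm : Continuous m) {R : ℝ}
    (h0 : ∀ p, R ≤ ‖p‖ → m p = 0) {p : Plane} (hp : ‖p‖ ≤ R) (e : Plane) :
    rayForm m (4 * R) p e = (2 * Real.pi)⁻¹ * ∫ q, m q * angleForm q p e := by
  rw [rayForm_apply hm, ← integral_add_left_eq_self _ p, ← integral_comp_polarCoord_symm,
    ← setIntegral_polarCoord_target (F := fun x => m (p + x.1 • unitDir x.2) *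
      (e.1 * (unitDir x.2).2 - e.2 * (unitDir x.2).1)) (by fun_prop)
      (by linarith [norm_nonneg p])]
  · congr 1
    refine setIntegral_congr_fun polarCoord.open_target.measurableSet ?_
    rintro ⟨r, θ⟩ ⟨hr, -⟩
    have hr0 : r ≠ 0 := (mem_Ioi.1 hr).ne'
    have hu : polarCoord.symm (r, θ) = r • unitDir θ := rfl
    have h1 : (r * Real.cos θ) ^ 2 + (r * Real.sin θ) ^ 2 = r ^ 2 := by
      rw [mul_pow, mul_pow, ← mul_add, Real.cos_sq_add_sin_sq, mul_one]
    simp only [hu, angleForm_apply, unitDir, Prod.fst_add, Prod.snd_add, Prod.smul_mk, smul_eq_mul]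
    rw [show (p.1 - (p.1 + r * Real.cos θ)) ^ 2 + (p.2 - (p.2 + r * Real.sin θ)) ^ 2 = r ^ 2 by
      rw [← h1]; ring]
    field_simp
    ring
  · intro r θ hr
    rw [h0 _ (le_norm_add_smul_unitDir hp hr θ), zero_mul]

theorem abs_angleForm_apply_le {q p : Plane} {δ : ℝ} (hδ : 0 < δ) (h : δ ≤ ‖p - q‖) (e : Plane) :
    |angleForm q p e| ≤ 2 / δ * ‖e‖ := by
  set x := p.1 - q.1 with hx
  set y := p.2 - q.2 with hy
  have hmax : δ ≤ max |x| |y| := h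
  have hsq : δ ^ 2 ≤ x ^ 2 + y ^ 2 := by
    rcases le_max_iff.1 hmax with h | h
    · nlinarith [sq_abs x, sq_nonneg y]
    · nlinarith [sq_abs y, sq_nonneg x]
  have hpos : 0 < x ^ 2 + y ^ 2 := (pow_pos hδ 2).trans_le hsq
  have hb : ∀ t : ℝ, t ^ 2 ≤ x ^ 2 + y ^ 2 → |t / (x ^ 2 + y ^ 2)| ≤ 1 / δ := fun t ht => by
    rw [abs_div, abs_of_pos hpos, div_le_div_iff₀ hpos hδ, one_mul]
    refine abs_le_of_sq_le_sq' ?_ hpos.le |>.2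
    rw [mul_pow, sq_abs, sq (x ^ 2 + y ^ 2)]
    exact mul_le_mul ht hsq (sq_nonneg _) hpos.le
  rw [angleForm_apply, ← hx, ← hy]
  refine (abs_add_le _ _).trans ?_
  rw [abs_mul, abs_mul]
  have h1 := mul_le_mul (hb (-y) (by nlinarith)) (norm_fst_le e) (abs_nonneg _) (by positivity)
  have h2 := mul_le_mul (hb x (by nlinarith)) (norm_snd_le e) (abs_nonneg _) (by positivity)
  rw [Real.norm_eq_abs] at h1 h2
  calc _ ≤ 1 / δ * ‖e‖ + 1 / δ * ‖e‖ := add_le_add h1 h2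
    _ = 2 / δ * ‖e‖ := by ring

/-- Fubini for the curve parameter and the centre q. The weight lives at distance at least δ from
the curve, so the singularity of the angle form is never met and 2/δ bounds the kernel. -/
theorem PiecewiseC1.curveIntegral_rayForm {a : Plane} {γ : Path a a} (hγ : PiecewiseC1 γ)
    {m : Plane → ℝ} (hm : Continuous m) {R : ℝ} (h0 : ∀ p, R ≤ ‖p‖ → m p = 0)
    (hR : range γ ⊆ Metric.ball 0 R) {δ : ℝ} (hδ : 0 < δ)
    (hδm : ∀ q, m q ≠ 0 → ∀ p ∈ range γ, δ ≤ ‖p - q‖) :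
    curveIntegral (rayForm m (4 * R)) γ = ∫ q, m q * windingNumber γ q := by
  have h1 : ∀ t, curveIntegralFun (rayForm m (4 * R)) γ t =
      ∫ q, (2 * Real.pi)⁻¹ * (m q * curveIntegralFun (angleForm q) γ t) := fun t => by
    have hp := hR (Path.extend_mem_range γ t)
    rw [mem_ball_zero_iff] at hp
    simp only [curveIntegralFun_def]
    rw [rayForm_eq_integral_angleForm hm h0 hp.le, MeasureTheory.integral_const_mul]
  rw [curveIntegral_def]
  simp only [h1]
  rw [intervalIntegral_integral_swap]
  · refine integral_congr_ae (Eventually.of_forall fun q => ?_)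
    simp only [intervalIntegral.integral_const_mul, windingNumber, curveIntegral_def]
    ring
  · have hD := hγ.integrable_derivWithin
    rw [intervalIntegrable_iff] at hD
    have hmi : Integrable m := by
      refine hm.integrable_of_hasCompactSupport ?_
      refine HasCompactSupport.intro (isCompact_closedBall (0 : Plane) R) fun p hp => h0 p ?_
      rw [mem_closedBall_zero_iff, not_le] at hp
      exact hp.le
    have hdom := (hD.norm.mul_prod hmi.norm).const_mul ((2 * Real.pi)⁻¹ * (2 / δ))
    refine hdom.mono ?_ (Eventually.of_forall ?_)
    · have hDm : AEStronglyMeasurable (fun x : ℝ × Plane => derivWithin γ.extend (Icc 0 1) x.1)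
          ((volume.restrict (uIoc 0 1)).prod volume) := hD.aestronglyMeasurable.comp_fst
      have hγc := γ.continuous_extend.measurable
      simp only [Function.uncurry_def, curveIntegralFun_def, angleForm_apply]
      have hk : Measurable fun x : ℝ × Plane => -((γ.extend x.1).2 - x.2.2) /
          (((γ.extend x.1).1 - x.2.1) ^ 2 + ((γ.extend x.1).2 - x.2.2) ^ 2) := by fun_prop
      have hg : Measurable fun x : ℝ × Plane => ((γ.extend x.1).1 - x.2.1) /
          (((γ.extend x.1).1 - x.2.1) ^ 2 + ((γ.extend x.1).2 - x.2.2) ^ 2) := by fun_prop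
      have hmm : Measurable fun x : ℝ × Plane => m x.2 := by fun_prop
      exact (hmm.aestronglyMeasurable.mul ((hk.aestronglyMeasurable.mul hDm.fst).add
        (hg.aestronglyMeasurable.mul hDm.snd))).const_mul _
    · rintro ⟨t, q⟩
      simp only [Function.uncurry_apply_pair, norm_mul, norm_norm, curveIntegralFun_def]
      by_cases hq : m q = 0
      · simp [hq]
      · have h2 := abs_angleForm_apply_le hδ (hδm q hq _ (Path.extend_mem_range γ t))
          (derivWithin γ.extend (Icc 0 1) t)
        rw [← Real.norm_eq_abs] at h2
        have hδ' : ‖2 / δ‖ = 2 / δ := Real.norm_of_nonneg (by positivity)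
        rw [hδ']
        calc _ ≤ ‖(2 * Real.pi)⁻¹‖ * (‖m q‖ * (2 / δ * ‖derivWithin γ.extend (Icc 0 1) t‖)) := by
              simp only [norm_mul, norm_inv] at *
              gcongr
          _ = _ := by simp only [norm_mul, norm_inv]; ring

open scoped Manifold in
-- The value 1 is taken on a whole δ-neighbourhood of K, so the derivative of χ vanishes on K and at
-- all points within δ of the curve.
theorem exists_contDiff_cutoff {K U : Set Plane} (hK : IsCompact K) (hU : IsOpen U) (hKU : K ⊆ U) :
    ∃ (χ : Plane → ℝ) (δ : ℝ), 0 < δ ∧ ContDiff ℝ 2 χ ∧ HasCompactSupport χ ∧ tsupport χ ⊆ U ∧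
      EqOn χ 1 (Metric.thickening δ K) := by
  obtain ⟨L, hLc, hKL, hLU⟩ := exists_compact_between hK hU hKU
  obtain ⟨δ, hδ, hδL⟩ := hK.exists_cthickening_subset_open isOpen_interior hKL
  obtain ⟨χ, hχ, -, hsupp, hone⟩ := exists_contMDiff_support_eq_eq_one_iff (n := 2) 𝓘(ℝ, Plane)
    (isOpen_interior (s := L)) Metric.isClosed_cthickening hδL
  have hts : tsupport χ ⊆ L := by
    rw [tsupport, hsupp]
    exact closure_minimal interior_subset hLc.isClosed
  exact ⟨χ, δ, hδ, hχ.contDiff, hLc.of_isClosed_subset (isClosed_tsupport _) hts, hts.trans hLU,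
    fun x hx => (hone x).1 (Metric.thickening_subset_cthickening _ _ hx)⟩

/-- Cauchy's theorem for a closed differentiable 1-form on a neighbourhood of a closed curve and
of the points it encloses. -/
theorem PiecewiseC1.curveIntegral_eq_zero_of_isClosedAt {a : Plane} {γ : Path a a}
    (hγ : PiecewiseC1 γ) {U : Set Plane} (hU : IsOpen U) (hγU : range γ ⊆ U)
    (hencU : enclosed γ ⊆ U) {ω : Plane → Plane →L[ℝ] ℝ} (hω : ∀ p ∈ U, IsClosedAt ω p) :
    curveIntegral ω γ = 0 := by
  set K := range γ ∪ enclosed γ with hK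
  obtain ⟨χ, δ, hδ, hχ, hcs, hsU, hone⟩ := exists_contDiff_cutoff
    (isCompact_range_union_enclosed (γ := γ)) hU (union_subset hγU hencU)
  set η : Plane → Plane →L[ℝ] ℝ := fun p => χ p • ω p with hη
  have hχd : Differentiable ℝ χ := hχ.differentiable two_ne_zero
  have hts : tsupport η ⊆ tsupport χ := tsupport_smul_subset_left χ ω
  have hηd : Differentiable ℝ η := fun p => by
    by_cases hp : p ∈ tsupport χ
    · exact (hχd p).smul (hω p (hsU hp)).1
    · exact (differentiableAt_const (0 : Plane →L[ℝ] ℝ)).congr_of_eventuallyEq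
        (notMem_tsupport_iff_eventuallyEq.1 fun h => hp (hts h))
  -- Closedness of ω cancels its derivatives and leaves dχ ∧ ω. This makes `curl η` continuous
  -- although the derivative of ω need not be.
  have hcurl : ∀ p ∈ U, curl η p =
      fderiv ℝ χ p (1, 0) * ω p (0, 1) - fderiv ℝ χ p (0, 1) * ω p (1, 0) := fun p hp => by
    have hd := (hω p hp).1
    rw [curl, hη, fderiv_fun_smul (hχd p) hd]
    simp only [add_apply, smul_apply, ContinuousLinearMap.smulRight_apply, smul_eq_mul,
      (hω p hp).2 (1, 0) (0, 1)]
    ring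
  have hfc : Continuous (fderiv ℝ χ) := hχ.continuous_fderiv two_ne_zero
  have hc : Continuous (curl η) := continuous_iff_continuousAt.2 fun p => by
    by_cases hp : p ∈ tsupport χ
    · have hωc : ContinuousAt ω p := (hω p (hsU hp)).1.continuousAt
      have : ContinuousAt (fun p => fderiv ℝ χ p (1, 0) * ω p (0, 1) -
          fderiv ℝ χ p (0, 1) * ω p (1, 0)) p :=
        ((hfc.continuousAt.clm_apply continuousAt_const).mul
          (hωc.clm_apply continuousAt_const)).sub
        ((hfc.continuousAt.clm_apply continuousAt_const).mul
          (hωc.clm_apply continuousAt_const))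
      exact this.congr (eventually_of_mem (hU.mem_nhds (hsU hp)) fun q hq => (hcurl q hq).symm)
    · have : (tsupport η)ᶜ ∈ 𝓝 p :=
        (isClosed_tsupport η).isOpen_compl.mem_nhds fun h => hp (hts h)
      exact continuousAt_const.congr
        (eventually_of_mem this fun q hq => (curl_eq_zero_of_notMem_tsupport hq).symm)
  have hcurl0 : ∀ p ∈ Metric.thickening δ K, curl η p = 0 := fun p hp => by
    by_cases hpU : p ∈ U
    · have h1 : χ =ᶠ[𝓝 p] fun _ => 1 :=
        eventually_of_mem (Metric.isOpen_thickening.mem_nhds hp) hone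
      rw [hcurl p hpU, h1.fderiv_eq]
      simp
    · exact curl_eq_zero_of_notMem_tsupport fun h => hpU (hsU (hts h))
  obtain ⟨R₁, hR₁⟩ := (isCompact_range γ.continuous).isBounded.exists_norm_le
  obtain ⟨R₂, hR₂⟩ := hcs.isCompact.isBounded.exists_norm_le
  set R := max R₁ R₂ + 1
  have hs : tsupport η ⊆ Metric.ball 0 R := fun p hp => by
    rw [mem_ball_zero_iff]
    linarith [hR₂ p (hts hp), le_max_right R₁ R₂]
  have hR : range γ ⊆ Metric.ball 0 R := fun p hp => by
    rw [mem_ball_zero_iff]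
    linarith [hR₁ p hp, le_max_left R₁ R₂]
  have heq : EqOn ω η (range γ) := fun p hp => by
    have h1 : χ p = 1 := hone (Metric.self_subset_thickening hδ K (Or.inl hp))
    simp [hη, h1]
  rw [curveIntegral_congr heq, hγ.curveIntegral_eq_curveIntegral_rayForm hηd hc hs hR,
    hγ.curveIntegral_rayForm hc ?_ hR hδ]
  -- At each q one factor vanishes: the curl on K, the winding number off K.
  · refine (MeasureTheory.integral_congr_ae (Eventually.of_forall fun q => ?_)).trans
      (MeasureTheory.integral_zero _ ℝ)
    by_cases hq : q ∈ K
    · simp only [hcurl0 q (Metric.self_subset_thickening hδ K hq), zero_mul]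
    · rw [hK, mem_union, not_or] at hq
      simp only [windingNumber_eq_zero_of_notMem_enclosed hγ hq.1 hq.2, mul_zero]
  · intro q hq p hp
    by_contra! hlt
    refine hq (hcurl0 q (Metric.mem_thickening_iff.2 ⟨p, Or.inl hp, ?_⟩))
    rwa [dist_comm, dist_eq_norm]
  · intro p hp
    refine curl_eq_zero_of_notMem_tsupport fun h => ?_
    have := hs h
    rw [mem_ball_zero_iff] at this
    linarith

end Curves

/-! ### Laurent series -/

/-- Near `z₀`, but not necessarily at `z₀`, the function `W` is the sum of the series
`∑ β n (z - z₀) ^ n` over all integers `n`. -/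
def IsLaurent (W : ℂ → ℂ) (z₀ : ℂ) (β : ℤ → ℂ) : Prop :=
  ∀ᶠ z in 𝓝[≠] z₀, HasSum (fun n : ℤ => β n * (z - z₀) ^ n) (W z)

theorem eventually_nhdsNE_iff {z₀ : ℂ} {P : ℂ → Prop} :
    (∀ᶠ z in 𝓝[≠] z₀, P z) ↔ ∃ ε > 0, ∀ z, z ≠ z₀ → ‖z - z₀‖ < ε → P z := by
  rw [eventually_nhdsWithin_iff, Metric.eventually_nhds_iff]
  simp only [dist_eq_norm, mem_compl_iff, mem_singleton_iff]
  exact exists_congr fun ε => and_congr_right fun _ => forall_congr' fun z => forall_comm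

theorem integral_exp_int_mul (n : ℤ) (hn : n ≠ 0) :
    ∫ φ in (0 : ℝ)..2 * Real.pi, Complex.exp (φ * Complex.I) ^ n = 0 := by
  have hc : (n * Complex.I : ℂ) ≠ 0 := mul_ne_zero (Int.cast_ne_zero.2 hn) Complex.I_ne_zero
  have h : ∀ φ : ℝ, Complex.exp (φ * Complex.I) ^ n = Complex.exp (n * Complex.I * φ) := fun φ => by
    rw [← Complex.exp_int_mul]; ring_nf
  simp only [h]
  rw [integral_exp_mul_complex hc]
  have : Complex.exp (n * Complex.I * ((2 * Real.pi : ℝ) : ℂ)) = 1 :=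
    Complex.exp_eq_one_iff.2 ⟨n, by push_cast; ring⟩
  rw [this]
  simp

namespace IsLaurent

variable {W : ℂ → ℂ} {z₀ : ℂ} {β : ℤ → ℂ}

/-- The mean of a Laurent series over a small circle is its constant term. -/
theorem integral_circle (h : IsLaurent W z₀ β) :
    ∀ᶠ ρ : ℝ in 𝓝[>] 0, ∫ φ in (0 : ℝ)..2 * Real.pi, W (z₀ + ρ * Complex.exp (φ * Complex.I)) =
      2 * Real.pi * β 0 := by
  obtain ⟨ε, hε, hs⟩ := eventually_nhdsNE_iff.1 h
  filter_upwards [Ioo_mem_nhdsGT hε] with ρ hρ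
  have hne : ∀ φ : ℝ, z₀ + ρ * Complex.exp (φ * Complex.I) ≠ z₀ := fun φ => by
    simp [hρ.1.ne', Complex.exp_ne_zero]
  have hnorm : ∀ φ : ℝ, ‖z₀ + ρ * Complex.exp (φ * Complex.I) - z₀‖ = ρ := fun φ => by
    simp [Complex.norm_exp_ofReal_mul_I, abs_of_pos hρ.1]
  have hsum : ∀ φ : ℝ, HasSum (fun n : ℤ => β n * (ρ * Complex.exp (φ * Complex.I)) ^ n)
      (W (z₀ + ρ * Complex.exp (φ * Complex.I))) := fun φ => by
    have := hs _ (hne φ) (by rw [hnorm]; exact hρ.2)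
    simpa using this
  have hbound : ∀ (n : ℤ) (φ : ℝ), ‖β n * (ρ * Complex.exp (φ * Complex.I)) ^ n‖ = ‖β n‖ * ρ ^ n :=
    fun n φ => by simp [Complex.norm_exp_ofReal_mul_I, abs_of_pos hρ.1]
  -- The norms of the terms depend on ρ only, so summability at φ = 0 dominates the series for all
  -- φ.
  have hsummable : Summable fun n : ℤ => ‖β n‖ * ρ ^ n := by
    have := (hsum 0).summable.norm
    simpa only [hbound] using this
  have key := intervalIntegral.hasSum_integral_of_dominated_convergence (μ := volume)
    (a := 0) (b := 2 * Real.pi) (fun n _ => ‖β n‖ * ρ ^ n)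
    (F := fun n φ => β n * (ρ * Complex.exp (φ * Complex.I)) ^ n)
    (f := fun φ => W (z₀ + ρ * Complex.exp (φ * Complex.I)))
    (fun n => ?_) (fun n => Eventually.of_forall fun φ _ => (hbound n φ).le)
    (Eventually.of_forall fun φ _ => hsummable) intervalIntegrable_const
    (Eventually.of_forall fun φ _ => hsum φ)
  · refine key.unique ?_
    have hterm : (fun n : ℤ => ∫ φ in (0 : ℝ)..2 * Real.pi,
        β n * (ρ * Complex.exp (φ * Complex.I)) ^ n) =
        fun n => if n = 0 then 2 * Real.pi * β 0 else 0 := by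
      funext n
      split_ifs with hn
      · simp [hn]
      · simp only [mul_zpow, ← mul_assoc]
        rw [intervalIntegral.integral_const_mul, integral_exp_int_mul n hn, mul_zero]
    rw [hterm]
    exact hasSum_ite_eq 0 _
  · refine Continuous.aestronglyMeasurable ?_
    have : ∀ φ : ℝ, (ρ : ℂ) * Complex.exp (φ * Complex.I) ≠ 0 := fun φ =>
      mul_ne_zero (by exact_mod_cast hρ.1.ne') (Complex.exp_ne_zero _)
    exact continuous_const.mul (Continuous.zpow₀ (by fun_prop) n fun φ => Or.inl (this φ))

theorem constantCoeff_eq_of_tendsto (h : IsLaurent W z₀ β) {l : ℂ}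
    (hl : Tendsto W (𝓝[≠] z₀) (𝓝 l)) : β 0 = l := by
  rw [← sub_eq_zero, ← norm_le_zero_iff]
  refine le_of_forall_pos_le_add fun η hη => ?_
  rw [zero_add]
  have hclose : ∀ᶠ z in 𝓝[≠] z₀, ‖W z - l‖ < η := by
    simpa only [dist_eq_norm] using Metric.tendsto_nhds.1 hl η hη
  obtain ⟨ε, hε, hs⟩ := eventually_nhdsNE_iff.1 hclose
  -- β 0 - l is now the mean, over a small circle, of a function of norm less than η.
  have hlau : IsLaurent (fun z => W z - l) z₀ (fun n => β n - if n = 0 then l else 0) := by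
    filter_upwards [h] with z hz
    have := hz.sub (hasSum_ite_eq (0 : ℤ) l)
    refine this.congr_fun fun n => ?_
    rw [sub_mul]
    split_ifs with hn <;> simp [hn]
  obtain ⟨ρ, hρ, hρε⟩ := (hlau.integral_circle.and (Ioo_mem_nhdsGT hε)).exists
  have hb : ‖∫ φ in (0 : ℝ)..2 * Real.pi, (W (z₀ + ρ * Complex.exp (φ * Complex.I)) - l)‖ ≤
      η * |2 * Real.pi - 0| := by
    refine intervalIntegral.norm_integral_le_of_norm_le_const fun φ _ => (hs _ ?_ ?_).le
    · simp [hρε.1.ne', Complex.exp_ne_zero]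
    · simpa [Complex.norm_exp_ofReal_mul_I, abs_of_pos hρε.1] using hρε.2
  rw [hρ] at hb
  have hpi : 0 < 2 * Real.pi := by positivity
  simp only [if_true, norm_mul, sub_zero, abs_of_pos hpi] at hb
  rw [Complex.norm_ofNat, Complex.norm_real, Real.norm_of_nonneg Real.pi_pos.le, mul_comm] at hb
  exact le_of_mul_le_mul_right hb hpi

theorem zpow_mul (h : IsLaurent W z₀ β) (k : ℤ) :
    IsLaurent (fun z => (z - z₀) ^ k * W z) z₀ (fun n => β (n - k)) := by
  filter_upwards [h, self_mem_nhdsWithin] with z hz hne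
  have hne' : z - z₀ ≠ 0 := sub_ne_zero.2 hne
  have := (hz.mul_left ((z - z₀) ^ k))
  rw [← (Equiv.subRight k).hasSum_iff] at this
  refine this.congr_fun fun n => ?_
  simp only [Function.comp_apply, Equiv.subRight_apply]
  rw [zpow_sub₀ hne']
  field_simp

theorem sub_monomial (h : IsLaurent W z₀ β) (k : ℤ) (r : ℂ) :
    IsLaurent (fun z => W z - r * (z - z₀) ^ k) z₀ (fun n => β n - if n = k then r else 0) := by
  filter_upwards [h] with z hz
  refine (hz.sub (hasSum_ite_eq k (r * (z - z₀) ^ k))).congr_fun fun n => ?_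
  rw [sub_mul]
  split_ifs with hn <;> simp [hn]

theorem summable_norm (h : IsLaurent W z₀ β) :
    ∃ ε > 0, ∀ ρ : ℝ, 0 < ρ → ρ < ε → Summable fun n : ℤ => ‖β n‖ * ρ ^ n := by
  obtain ⟨ε, hε, hs⟩ := eventually_nhdsNE_iff.1 h
  refine ⟨ε, hε, fun ρ h0 hρ => ?_⟩
  have := (hs (z₀ + ρ) (by simp [h0.ne']) (by simpa [abs_of_pos h0] using hρ)).summable.norm
  simpa [abs_of_pos h0] using this

end IsLaurent

theorem differentiableOn_tsum_pow {c : ℕ → ℂ} {ρ : ℝ} (hc : Summable fun n => ‖c n‖ * ρ ^ n) :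
    DifferentiableOn ℂ (fun z => ∑' n, c n * z ^ n) (Metric.ball 0 ρ) := by
  refine Complex.differentiableOn_tsum_of_summable_norm hc (fun n => by fun_prop)
    Metric.isOpen_ball fun n z hz => ?_
  rw [mem_ball_zero_iff] at hz
  rw [norm_mul, norm_pow]
  gcongr

namespace IsLaurent

variable {W : ℂ → ℂ} {z₀ : ℂ} {β : ℤ → ℂ}

/-- A Laurent series is the sum of a holomorphic function at the centre, of the term with
exponent `-1`, and of the remaining principal part, an entire function of `(z - z₀)⁻¹`. -/
theorem exists_decomposition (h : IsLaurent W z₀ β) :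
    ∃ E H : ℂ → ℂ, (∀ᶠ z in 𝓝 z₀, DifferentiableAt ℂ E z) ∧ E z₀ = β 0 ∧
      Differentiable ℂ H ∧ ((∀ n < 0, β n = 0) → H = 0) ∧
      ∀ᶠ z in 𝓝[≠] z₀, W z = E z + (β (-1) / (z - z₀) + H (z - z₀)⁻¹ / (z - z₀) ^ 2) := by
  obtain ⟨ε, hε, hsum⟩ := h.summable_norm
  have hpos : ∀ ρ : ℝ, 0 < ρ → ρ < ε → Summable fun n : ℕ => ‖β n‖ * ρ ^ n := fun ρ h0 hρ => by
    have := (hsum ρ h0 hρ).comp_injective (i := ((↑) : ℕ → ℤ)) Nat.cast_injective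
    simpa [Function.comp_def] using this
  -- Radius R in the variable 1 / (z - z₀) is radius R⁻¹ < ε around z₀; all large R are allowed, so
  -- H is entire.
  have hneg : ∀ R : ℝ, ε⁻¹ < R → Summable fun n : ℕ => ‖β (-(n + 2))‖ * R ^ n := fun R hR => by
    have hR0 : 0 < R := (inv_pos.2 hε).trans hR
    have hinj : Function.Injective fun n : ℕ => (-(n + 2) : ℤ) := fun m n hmn => by
      simp only at hmn; omega
    have := ((hsum R⁻¹ (inv_pos.2 hR0) (inv_lt_of_inv_lt₀ hε hR)).comp_injective hinj).mul_left
      ((R ^ 2)⁻¹)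
    refine this.congr fun n => ?_
    have : (R⁻¹ : ℝ) ^ (-(n + 2) : ℤ) = R ^ n * R ^ 2 := by
      rw [zpow_neg, inv_zpow, inv_inv, ← pow_add]; norm_cast
    simp only [Function.comp_apply, this]
    field_simp
  have hH : Differentiable ℂ fun u : ℂ => ∑' n : ℕ, β (-(n + 2)) * u ^ n := fun u => by
    have := differentiableOn_tsum_pow (c := fun n : ℕ => β (-(n + 2)))
      (hneg (max (ε⁻¹) ‖u‖ + 1) (by linarith [le_max_left ε⁻¹ ‖u‖]))
    refine this.differentiableAt (Metric.isOpen_ball.mem_nhds ?_)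
    rw [mem_ball_zero_iff]
    linarith [le_max_right ε⁻¹ ‖u‖]
  refine ⟨fun z => ∑' n : ℕ, β n * (z - z₀) ^ n, fun u => ∑' n : ℕ, β (-(n + 2)) * u ^ n,
    ?_, ?_, hH, ?_, ?_⟩
  · filter_upwards [Metric.ball_mem_nhds z₀ (half_pos hε)] with z hz
    have h1 := differentiableOn_tsum_pow (c := fun n : ℕ => β n)
      (hpos (ε / 2) (half_pos hε) (half_lt_self hε))
    have h2 : DifferentiableAt ℂ (fun z => ∑' n : ℕ, β n * z ^ n) (z - z₀) :=
      h1.differentiableAt (Metric.isOpen_ball.mem_nhds (by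
        rwa [mem_ball_zero_iff, ← dist_eq_norm]))
    exact h2.comp z (differentiableAt_id.sub_const z₀)
  · simp only [sub_self]
    rw [tsum_eq_single 0 fun n hn => by simp [hn]]
    simp
  · intro h0
    funext u
    have h1 : ∀ n : ℕ, β (-(n + 2)) = 0 := fun n => h0 _ (by omega)
    simp only [h1, zero_mul, tsum_zero, Pi.zero_apply]
  · filter_upwards [h, self_mem_nhdsWithin] with z hz hne
    have hne' : z - z₀ ≠ 0 := sub_ne_zero.2 hne
    have h1 : Summable fun n : ℕ => β n * (z - z₀) ^ (n : ℤ) :=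
      hz.summable.comp_injective (i := ((↑) : ℕ → ℤ)) Nat.cast_injective
    have hinj : Function.Injective fun n : ℕ => (-(n + 1) : ℤ) := fun m n hmn => by
      simp only at hmn; omega
    have h2 : Summable fun n : ℕ => β (-(n + 1)) * (z - z₀) ^ (-(n + 1) : ℤ) :=
      hz.summable.comp_injective hinj
    rw [← hz.tsum_eq, tsum_of_nat_of_neg_add_one (f := fun n : ℤ => β n * (z - z₀) ^ n) h1 h2,
      h2.tsum_eq_zero_add]
    simp only [zpow_natCast]
    congr 1
    congr 1
    · simp [zpow_neg, div_eq_mul_inv]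
    · rw [div_eq_mul_inv, ← tsum_mul_right]
      refine tsum_congr fun n => ?_
      have e1 : (-(((n + 1 : ℕ) : ℤ) + 1)) = -((n : ℤ) + 2) := by push_cast; ring
      have e2 : (z - z₀) ^ (-((n : ℤ) + 2)) = ((z - z₀)⁻¹) ^ n * ((z - z₀) ^ 2)⁻¹ := by
        rw [zpow_neg, inv_pow, ← mul_inv, ← pow_add]; norm_cast
      rw [e1, e2, mul_assoc]

theorem tendsto_of_nonneg (h : IsLaurent W z₀ β) (h0 : ∀ n < 0, β n = 0) :
    Tendsto W (𝓝[≠] z₀) (𝓝 (β 0)) := by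
  obtain ⟨E, H, hE, hE0, -, hH0, hW⟩ := h.exists_decomposition
  have hcont : Tendsto E (𝓝[≠] z₀) (𝓝 (β 0)) :=
    hE0 ▸ hE.self_of_nhds.continuousAt.tendsto.mono_left nhdsWithin_le_nhds
  refine hcont.congr' ?_
  filter_upwards [hW] with z hz
  rw [hz, hH0 h0, h0 (-1) (by norm_num)]
  simp

/-- If `(z - z₀) ^ N W` is bounded in the limit, then the coefficients below `-N` vanish. -/
theorem coeff_eq_zero_of_tendsto (h : IsLaurent W z₀ β) {N : ℕ} {l : ℂ}
    (hl : Tendsto (fun z => (z - z₀) ^ N * W z) (𝓝[≠] z₀) (𝓝 l)) {n : ℤ} (hn : n < -N) :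
    β n = 0 := by
  -- β n is the constant coefficient of (z - z₀)^(-n) W, which tends to 0 because -n exceeds N.
  have h1 := (h.zpow_mul (-n)).constantCoeff_eq_of_tendsto (l := 0) ?_
  · simpa using h1
  · obtain ⟨k, hk⟩ : ∃ k : ℕ, -n = (k + 1 : ℕ) + N := ⟨(-n - N - 1).toNat, by omega⟩
    have h2 : Tendsto (fun z : ℂ => (z - z₀) ^ (k + 1)) (𝓝[≠] z₀) (𝓝 0) := by
      have : Continuous fun z : ℂ => (z - z₀) ^ (k + 1) := by fun_prop
      simpa using (this.tendsto z₀).mono_left (nhdsWithin_le_nhds (s := {z₀}ᶜ))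
    have h3 := h2.mul hl
    rw [zero_mul] at h3
    refine h3.congr' (Eventually.of_forall fun z => ?_)
    rw [← mul_assoc, ← pow_add, hk]
    norm_cast

end IsLaurent

/-! ### The residue theorem for closed 1-forms -/

/-- The singular part of a Laurent series at the point `q`. -/
def singularPart (c : ℂ) (H : ℂ → ℂ) (q : Plane) (z : ℂ) : ℂ :=
  c / (z - toC q) + H (z - toC q)⁻¹ / (z - toC q) ^ 2

theorem differentiableAt_singularPart (c : ℂ) {H : ℂ → ℂ} (hH : Differentiable ℂ H) {p q : Plane}
    (h : p ≠ q) : DifferentiableAt ℂ (singularPart c H q) (toC p) := by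
  have hne := toC_sub_ne_zero h
  have h1 : DifferentiableAt ℂ (fun z => (z - toC q)⁻¹) (toC p) := by
    fun_prop (disch := assumption)
  have h2 : DifferentiableAt ℂ (fun z => H (z - toC q)⁻¹) (toC p) := (hH _).comp (toC p) h1
  unfold singularPart
  fun_prop (disch := first | assumption | exact pow_ne_zero 2 hne)

/-- The function log |z - q| is single-valued, unlike the complex logarithm; this is why the real
part of a residue does not contribute to the integral. -/
theorem hasFDerivAt_log_normSq {p q : Plane} (h : p ≠ q) :
    HasFDerivAt (fun p : Plane => Real.log (Complex.normSq (toC p - toC q)) / 2)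
      (reForm (fun z => 1 / (z - toC q)) p) p := by
  have hne : Complex.normSq (toC p - toC q) ≠ 0 := by
    rw [Ne, Complex.normSq_eq_zero]; exact toC_sub_ne_zero h
  have he : (fun p : Plane => Complex.normSq (toC p - toC q)) =
      fun p => (p.1 - q.1) * (p.1 - q.1) + (p.2 - q.2) * (p.2 - q.2) := by
    funext p; simp [Complex.normSq_apply]
  have h1 : HasFDerivAt (fun p : Plane => p.1 - q.1) (ContinuousLinearMap.fst ℝ ℝ ℝ) p :=
    hasFDerivAt_fst.sub_const _
  have h2 : HasFDerivAt (fun p : Plane => p.2 - q.2) (ContinuousLinearMap.snd ℝ ℝ ℝ) p :=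
    hasFDerivAt_snd.sub_const _
  have h3 := ((h1.mul h1).add (h2.mul h2)).congr_of_eventuallyEq
    (f₁ := fun p : Plane => Complex.normSq (toC p - toC q)) (Eventually.of_forall (congrFun he))
  refine ((h3.log hne).mul_const (2⁻¹ : ℝ)).congr_fderiv ?_
  ext
  · simp [reForm_apply, Complex.inv_re]
    ring
  · simp [reForm_apply, Complex.inv_im]
    ring

/-- The residue formula for a single singular part. -/
theorem PiecewiseC1.curveIntegral_singularPart {a : Plane} {γ : Path a a} (hγ : PiecewiseC1 γ)
    (c : ℂ) {H : ℂ → ℂ} (hH : Differentiable ℂ H) {q : Plane} (hq : q ∉ range γ) :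
    curveIntegral (reForm (singularPart c H q)) γ = -(2 * Real.pi) * c.im * windingNumber γ q := by
  have hpq : ∀ p ∈ range γ, p ≠ q := fun p hp h => hq (h ▸ hp)
  have hc : ContinuousOn (reForm (singularPart c H q)) (range γ) := fun p hp =>
    (continuousAt_reForm
      (differentiableAt_singularPart c hH (hpq p hp)).continuousAt).continuousWithinAt
  have ha : ContinuousOn (c.im • angleForm q) (range γ) := (continuousOn_angleForm hq).const_smul _
  obtain ⟨G, hG⟩ := hH.isExactOn_univ
  -- Adding Im c · dφ removes the only part without a global primitive. If G' = H, then -G(1 / (z -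
  -- q)) is a primitive of the H-term.
  have h0 : curveIntegral (reForm (singularPart c H q) + c.im • angleForm q) γ = 0 := by
    refine hγ.curveIntegral_eq_zero (hc.add ha) (f := fun p =>
      c.re * (Real.log (Complex.normSq (toC p - toC q)) / 2) + (-G (toC p - toC q)⁻¹).re) ?_
    intro p hp
    have hne := toC_sub_ne_zero (hpq p hp)
    have hG' : HasDerivAt (fun z => -G (z - toC q)⁻¹)
        (H (toC p - toC q)⁻¹ / (toC p - toC q) ^ 2) (toC p) := by
      have h1 : HasDerivAt (fun z => (z - toC q)⁻¹) (-1 / (toC p - toC q) ^ 2) (toC p) :=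
        ((hasDerivAt_id _).sub_const _).inv hne
      refine ((hG _ (mem_univ _)).comp (toC p) h1).neg.congr_deriv ?_
      ring
    have h2 := hasFDerivAt_reForm_of_hasDerivAt
      (f := fun z => H (z - toC q)⁻¹ / (z - toC q) ^ 2) hG'
    refine (((hasFDerivAt_log_normSq (hpq p hp)).const_mul c.re).add h2).congr_fderiv ?_
    rw [Pi.add_apply, Pi.smul_apply, angleForm_eq_reForm]
    ext <;>
    · simp [reForm_apply, singularPart, Complex.div_re, Complex.div_im]
      ring
  rw [curveIntegral_add (hγ.curveIntegrable hc) (hγ.curveIntegrable ha)] at h0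
  have h1 : curveIntegral (fun p => (c.im • angleForm q) p) γ =
      c.im * curveIntegral (angleForm q) γ := curveIntegral_smul
  rw [h1] at h0
  rw [windingNumber, eq_neg_of_add_eq_zero_left h0]
  field_simp

/-- The residue theorem in terms of closed 1-forms: if subtracting the form `σ q` removes the
singularity of `ω` at `q`, then the integral of `ω` is the sum of those of the forms `σ q`. -/
theorem PiecewiseC1.curveIntegral_eq_sum {a : Plane} {γ : Path a a} (hγ : PiecewiseC1 γ)
    {U : Set Plane} (hU : IsOpen U) (hγU : range γ ⊆ U) (hencU : enclosed γ ⊆ U)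
    {σ : Plane → Plane → Plane →L[ℝ] ℝ} (T : Finset Plane) :
    ∀ {ω : Plane → Plane →L[ℝ] ℝ}, (∀ q ∈ T, q ∉ range γ) →
    (∀ p ∈ U, p ∉ T → IsClosedAt ω p) → (∀ q ∈ T, ∀ p ≠ q, IsClosedAt (σ q) p) →
    (∀ q ∈ T, ∃ τ, IsClosedAt τ q ∧ ω - σ q =ᶠ[𝓝[≠] q] τ) →
    curveIntegral ω γ = ∑ q ∈ T, curveIntegral (σ q) γ := by
  classical
  induction T using Finset.induction_on with
  | empty =>
    intro ω _ hω _ _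
    rw [Finset.sum_empty]
    exact hγ.curveIntegral_eq_zero_of_isClosedAt hU hγU hencU fun p hp => hω p hp (by simp)
  | insert q T hqT ih =>
    intro ω hT hω hσ hτ
    obtain ⟨τ, hτc, hτe⟩ := hτ q (Finset.mem_insert_self q T)
    have hqγ := hT q (Finset.mem_insert_self q T)
    -- The value at q itself is arbitrary, so it is reset to that of the closed extension τ; the
    -- singularity at q is then gone.
    set ω' := Function.update (ω - σ q) q (τ q) with hω'
    have hupd : ∀ p, p ≠ q → ω' =ᶠ[𝓝 p] ω - σ q := fun p hp =>
      eventually_of_mem (isOpen_ne.mem_nhds hp) fun x hx => Function.update_of_ne hx _ _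
    have hσq := hσ q (Finset.mem_insert_self q T)
    have hne : ∀ q' ∈ T, q' ≠ q := fun q' hq' h => hqT (h ▸ hq')
    have hpγ : ∀ p ∈ range γ, p ≠ q := fun p hp h => hqγ (h ▸ hp)
    have hωc : ContinuousOn ω (range γ) := fun p hp =>
      (hω p (hγU hp) fun h => hT p h hp).1.continuousAt.continuousWithinAt
    have hσc : ContinuousOn (σ q) (range γ) := fun p hp =>
      (hσq p (hpγ p hp)).1.continuousAt.continuousWithinAt
    have key := ih (ω := ω') (fun q' hq' => hT q' (Finset.mem_insert_of_mem hq')) ?_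
      (fun q' hq' => hσ q' (Finset.mem_insert_of_mem hq')) ?_
    · have hEq : EqOn ω' (ω - σ q) (range γ) := fun p hp =>
        Function.update_of_ne (hpγ p hp) _ _
      rw [curveIntegral_congr hEq, curveIntegral_sub (hγ.curveIntegrable hωc)
        (hγ.curveIntegrable hσc)] at key
      rw [Finset.sum_insert hqT]
      linarith
    · intro p hp hpT
      by_cases hpq : p = q
      · subst hpq
        refine hτc.congr ?_
        rw [eventuallyEq_nhdsWithin_iff] at hτe
        filter_upwards [hτe] with x hx
        by_cases hxp : x = p
        · rw [hxp, hω', Function.update_self]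
        · rw [hω', Function.update_of_ne hxp]
          exact hx hxp
      · exact ((hω p hp (by simp [hpq, hpT])).sub (hσq p hpq)).congr (hupd p hpq)
    · intro q' hq'
      obtain ⟨τ', hτ'c, hτ'e⟩ := hτ q' (Finset.mem_insert_of_mem hq')
      refine ⟨τ' - σ q, hτ'c.sub (hσq q' (hne q' hq')), ?_⟩
      filter_upwards [hτ'e, nhdsWithin_le_nhds (hupd q' (hne q' hq'))] with x hx hx'
      rw [Pi.sub_apply] at hx ⊢
      rw [hx', Pi.sub_apply, Pi.sub_apply, ← hx]
      abel

/-! ### The even subalgebra as the complex numbers -/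

theorem coords_evenElem (u v : ℝ) : coords (evenElem u v) = (u, 0, 0, v) := by
  simpa [evenElem] using coords_basis u 0 0 v

theorem coords_injective : Function.Injective coords := fun a b h => by
  rw [basis_coords a, basis_coords b, h]

theorem continuous_coords : Continuous coords := continuous_induced_dom

instance : T2Space KahlerAlgebra := T2Space.of_injective_continuous coords_injective
  continuous_coords

theorem continuous_areaPart : Continuous areaPart :=
  continuous_snd.comp (continuous_snd.comp (continuous_snd.comp continuous_coords))

/-- The even element `u + v dxdy` that corresponds to the complex number `u + v i`. -/
def toK : ℂ →+ KahlerAlgebra where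
  toFun z := evenElem z.re z.im
  map_zero' := by simp [evenElem]
  map_add' z w := by
    simp only [evenElem, Complex.add_re, Complex.add_im, map_add]
    module

theorem toK_apply (z : ℂ) : toK z = evenElem z.re z.im := rfl

/-- The complex number that corresponds to the even part of an element. -/
def evenPart : KahlerAlgebra →+ ℂ where
  toFun a := ⟨scalarPart a, areaPart a⟩
  map_zero' := by apply Complex.ext <;> simp [scalarPart, areaPart, coords]
  map_add' a b := by apply Complex.ext <;> simp [scalarPart, areaPart, coords]

@[simp] theorem evenPart_toK (z : ℂ) : evenPart (toK z) = z := by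
  apply Complex.ext <;> simp [evenPart, toK_apply, scalarPart, areaPart, coords_evenElem]

theorem toK_injective : Function.Injective toK := Function.LeftInverse.injective evenPart_toK

theorem areaPart_toK (z : ℂ) : areaPart (toK z) = z.im := areaPart_evenElem _ _

theorem toK_mul (z w : ℂ) : toK (z * w) = toK z * toK w := by
  simp only [toK_apply, evenElem_mul, Complex.mul_re, Complex.mul_im]

theorem toK_one : toK 1 = 1 := by simp [toK_apply, evenElem_one_zero]

theorem toK_pow (z : ℂ) (n : ℕ) : toK (z ^ n) = toK z ^ n := by
  induction n with
  | zero => simp [toK_one]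
  | succ n ih => rw [pow_succ, pow_succ, toK_mul, ih]

theorem continuous_toK : Continuous toK := by
  refine continuous_induced_rng.2 ?_
  have : coords ∘ toK = fun z : ℂ => (z.re, 0, 0, z.im) := funext fun z => coords_evenElem _ _
  rw [this]
  fun_prop

theorem continuous_evenPart : Continuous evenPart := by
  have : ⇑evenPart = fun a => Complex.equivRealProdCLM.symm ((coords a).1, (coords a).2.2.2) :=
    rfl
  rw [this]
  have := continuous_coords
  fun_prop

theorem zElem_eq_toK (p : Plane) : zElem p = toK (toC p) := by
  simp [toK_apply, zElem]

theorem zElem_sub_eq_toK (p q : Plane) : zElem (p - q) = toK (toC p - toC q) := by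
  rw [zElem_eq_toK, map_sub]

theorem inverse_toK (z : ℂ) : Ring.inverse (toK z) = toK z⁻¹ := by
  rcases eq_or_ne z 0 with rfl | hz
  · simp
  · have h1 : toK z * toK z⁻¹ = 1 := by rw [← toK_mul, mul_inv_cancel₀ hz, toK_one]
    have h2 : toK z⁻¹ * toK z = 1 := by rw [← toK_mul, inv_mul_cancel₀ hz, toK_one]
    exact Ring.inverse_unit ⟨toK z, toK z⁻¹, h1, h2⟩

theorem intPow_toK (z : ℂ) (n : ℤ) : intPow (toK z) n = toK (z ^ n) := by
  cases n with
  | ofNat n => simp [intPow, toK_pow]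
  | negSucc n => simp [intPow, inverse_toK, ← toK_pow, zpow_negSucc]

theorem toK_mem_even (z : ℂ) :
    toK z ∈ CliffordAlgebra.even (CliffordAlgebraQuaternion.Q (1 : ℝ) (1 : ℝ)) :=
  add_mem (algebraMap_mem _ _) (Subalgebra.smul_mem _
    (CliffordAlgebra.ι_mul_ι_mem_evenOdd_zero _ _ _) _)

/-- The grade involution fixes even elements but negates `dx` and `dy`, so those two coordinates
vanish. -/
theorem toK_evenPart_of_mem_even {a : KahlerAlgebra}
    (ha : a ∈ CliffordAlgebra.even (CliffordAlgebraQuaternion.Q (1 : ℝ) (1 : ℝ))) :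
    toK (evenPart a) = a := by
  have hinv := CliffordAlgebra.involute_eq_of_mem_even ha
  obtain ⟨s, x, y, t, rfl⟩ : ∃ s x y t : ℝ,
      a = algebraMap ℝ KahlerAlgebra s + x • dx + y • dy + t • dxdy := ⟨_, _, _, _, basis_coords a⟩
  have h1 : CliffordAlgebra.involute
      (algebraMap ℝ KahlerAlgebra s + x • dx + y • dy + t • dxdy) =
      algebraMap ℝ KahlerAlgebra s + (-x) • dx + (-y) • dy + t • dxdy := by
    simp [dx, dy, dxdy, covector]
  rw [h1] at hinv
  have h2 := congrArg coords hinv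
  rw [coords_basis, coords_basis] at h2
  simp only [Prod.mk.injEq, true_and] at h2
  have hx : x = 0 := by linarith [h2.1]
  have hy : y = 0 := by linarith [h2.2.1]
  subst hx hy
  have h3 : algebraMap ℝ KahlerAlgebra s + (0 : ℝ) • dx + (0 : ℝ) • dy + t • dxdy = toK ⟨s, t⟩ := by
    simp [toK_apply, evenElem]
  rw [h3, evenPart_toK]

/-- The function on the plane with even values that corresponds to a complex function. -/
def evenFun (W : ℂ → ℂ) (p : Plane) : KahlerAlgebra := toK (W (toC p))

/-! ### Transfer of limits, series and poles between the plane and ℂ -/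

theorem map_toC_nhdsNE (q : Plane) : map toC (𝓝[≠] q) = 𝓝[≠] (toC q) := by
  have h : IsInducing toC := Complex.equivRealProdCLM.symm.toHomeomorph.isInducing
  rw [h.map_nhdsWithin_eq, image_compl_eq ⟨toC_injective, toC_surjective⟩, image_singleton]

theorem eventually_toC {q : Plane} {P : ℂ → Prop} :
    (∀ᶠ p in 𝓝[≠] q, P (toC p)) ↔ ∀ᶠ z in 𝓝[≠] (toC q), P z := by
  rw [← map_toC_nhdsNE, eventually_map]

theorem tendsto_toC {X : Type*} {q : Plane} {f : ℂ → X} {l : Filter X} :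
    Tendsto (fun p => f (toC p)) (𝓝[≠] q) l ↔ Tendsto f (𝓝[≠] (toC q)) l := by
  rw [← map_toC_nhdsNE, tendsto_map'_iff]
  rfl

instance (q : Plane) : (𝓝[≠] q).NeBot := by
  rw [← map_neBot_iff toC, map_toC_nhdsNE]
  infer_instance

theorem tendsto_evenFun_iff {W : ℂ → ℂ} {q : Plane} {l : ℂ} :
    Tendsto (evenFun W) (𝓝[≠] q) (𝓝 (toK l)) ↔ Tendsto W (𝓝[≠] (toC q)) (𝓝 l) := by
  rw [← tendsto_toC]
  constructor
  · intro h
    simpa [Function.comp_def, evenFun] using (continuous_evenPart.tendsto _).comp h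
  · exact fun h => (continuous_toK.tendsto l).comp h

/-- `toK ∘ evenPart` is continuous and fixes all values of the function, hence also their limit. -/
theorem toK_evenPart_of_tendsto {W : ℂ → ℂ} {q : Plane} {a : KahlerAlgebra}
    (h : Tendsto (evenFun W) (𝓝[≠] q) (𝓝 a)) : toK (evenPart a) = a := by
  have h1 := ((continuous_toK.comp continuous_evenPart).tendsto a).comp h
  have h2 : (toK ∘ evenPart) ∘ evenFun W = evenFun W :=
    funext fun p => congrArg toK (evenPart_toK _)
  rw [h2] at h1
  exact tendsto_nhds_unique h1 h

theorem zPow_mul_evenFun (W : ℂ → ℂ) (q : Plane) (m : ℕ) :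
    (fun p => zElem (p - q) ^ m * evenFun W p) = evenFun fun z => (z - toC q) ^ m * W z := by
  funext p
  rw [evenFun, evenFun, zElem_sub_eq_toK, ← toK_pow, ← toK_mul]

theorem zMul_evenFun (W : ℂ → ℂ) (q : Plane) :
    zMul q (evenFun W) = evenFun fun z => (z - toC q) * W z := by
  funext p
  rw [zMul, evenFun, evenFun, zElem_sub_eq_toK, ← toK_mul]

theorem subtractPole_evenFun (W : ℂ → ℂ) (q : Plane) (m : ℕ) (r : ℂ) :
    subtractPole (evenFun W) q m (toK r) =
      evenFun fun z => W z - r * (z - toC q) ^ (-(m : ℤ)) := by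
  funext p
  rw [subtractPole, evenFun, evenFun, zElem_sub_eq_toK, intPow_toK, ← toK_mul, ← map_sub]

theorem isIntegerSeries_evenFun {W : ℂ → ℂ} {q : Plane} {β : ℤ → ℂ} :
    IsIntegerSeries (evenFun W) q (fun n => toK (β n)) ↔ IsLaurent W (toC q) β := by
  rw [IsIntegerSeries, IsLaurent, ← eventually_toC]
  simp only [toK_mem_even, implies_true, true_and, zElem_sub_eq_toK, intPow_toK, ← toK_mul]
  refine eventually_congr (Eventually.of_forall fun p => ⟨fun h => ?_, fun h => ?_⟩)
  · simpa [Function.comp_def, evenFun] using h.map evenPart continuous_evenPart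
  · exact h.map toK continuous_toK

theorem IsIntegerSeries.exists_isLaurent {W : ℂ → ℂ} {q : Plane} {b : ℤ → KahlerAlgebra}
    (h : IsIntegerSeries (evenFun W) q b) :
    ∃ β, IsLaurent W (toC q) β ∧ ∀ n, b n = toK (β n) := by
  have hb : b = fun n => toK (evenPart (b n)) :=
    funext fun n => (toK_evenPart_of_mem_even (h.1 n)).symm
  exact ⟨fun n => evenPart (b n), isIntegerSeries_evenFun.1 (hb ▸ h), fun n => congrFun hb n⟩

/-! ### Poles and successive subtraction -/

theorem tendsto_pow_mul_zero {W : ℂ → ℂ} {z₀ l : ℂ} {n m : ℕ} (hnm : n < m)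
    (h : Tendsto (fun z => (z - z₀) ^ n * W z) (𝓝[≠] z₀) (𝓝 l)) :
    Tendsto (fun z => (z - z₀) ^ m * W z) (𝓝[≠] z₀) (𝓝 0) := by
  obtain ⟨k, rfl⟩ := Nat.exists_eq_add_of_lt hnm
  have hc : Continuous fun z : ℂ => (z - z₀) ^ (k + 1) := by fun_prop
  have h2 : Tendsto (fun z : ℂ => (z - z₀) ^ (k + 1)) (𝓝[≠] z₀) (𝓝 0) := by
    simpa using (hc.tendsto z₀).mono_left (nhdsWithin_le_nhds (s := {z₀}ᶜ))
  have h3 := h2.mul h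
  rw [zero_mul] at h3
  exact h3.congr fun z => by ring

/-- Minimality of m is automatic: a limit for a lower power forces the limit 0 for the power m. -/
theorem hasPole_evenFun_iff {W : ℂ → ℂ} {q : Plane} {m : ℕ} {a : KahlerAlgebra} :
    HasPole (evenFun W) q m a ↔ 1 ≤ m ∧ ∃ r ≠ 0, a = toK r ∧
      Tendsto (fun z => (z - toC q) ^ m * W z) (𝓝[≠] (toC q)) (𝓝 r) := by
  constructor
  · intro h
    have ht := h.tendsto
    rw [zPow_mul_evenFun] at ht
    have ha := toK_evenPart_of_tendsto ht
    refine ⟨h.one_le, evenPart a, fun h0 => h.ne_zero ?_, ha.symm, ?_⟩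
    · rw [← ha, h0, map_zero]
    · rw [← ha] at ht
      exact tendsto_evenFun_iff.1 ht
  · rintro ⟨hm, r, hr, rfl, ht⟩
    refine ⟨hm, fun h0 => hr (toK_injective (h0.trans (map_zero toK).symm)), ?_, ?_⟩
    · rw [zPow_mul_evenFun]
      exact tendsto_evenFun_iff.2 ht
    · rintro n - hn ⟨b, -, hb⟩
      rw [zPow_mul_evenFun] at hb
      rw [← toK_evenPart_of_tendsto hb, tendsto_evenFun_iff] at hb
      exact hr (tendsto_nhds_unique ht (tendsto_pow_mul_zero hn hb))

/-- After the subtraction, (z - z₀)^m times the function tends to 0, which rules out a nonzero limit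
for every exponent m' ≥ m. -/
theorem HasPole.order_subtractPole_le {W : ℂ → ℂ} {q : Plane} {m m' : ℕ} {a a' : KahlerAlgebra}
    (h : HasPole (evenFun W) q m a) (h' : HasPole (subtractPole (evenFun W) q m a) q m' a') :
    m' ≤ m - 1 := by
  obtain ⟨-, r, -, rfl, ht⟩ := hasPole_evenFun_iff.1 h
  rw [subtractPole_evenFun] at h'
  obtain ⟨-, r', hr', -, ht'⟩ := hasPole_evenFun_iff.1 h'
  have h0 : Tendsto (fun z => (z - toC q) ^ m * (W z - r * (z - toC q) ^ (-(m : ℤ))))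
      (𝓝[≠] (toC q)) (𝓝 0) := by
    have := ht.sub_const r
    rw [sub_self] at this
    refine this.congr' ?_
    filter_upwards [self_mem_nhdsWithin] with z hz
    have hz' : z - toC q ≠ 0 := sub_ne_zero.2 hz
    rw [zpow_neg, zpow_natCast]
    field_simp
  by_contra! hlt
  rcases (show m ≤ m' by omega).eq_or_lt with rfl | hlt'
  · exact hr' (tendsto_nhds_unique ht' h0)
  · exact hr' (tendsto_nhds_unique ht' (tendsto_pow_mul_zero hlt' h0))

theorem IsLaurent.residue_eq_of_tendsto {W : ℂ → ℂ} {z₀ : ℂ} {β : ℤ → ℂ} (h : IsLaurent W z₀ β)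
    {l : ℂ} (hl : Tendsto (fun z => (z - z₀) * W z) (𝓝[≠] z₀) (𝓝 l)) : β (-1) = l := by
  have := (h.zpow_mul 1).constantCoeff_eq_of_tendsto (l := l) (by simpa using hl)
  simpa using this

theorem SuccessiveSubtraction.mono {q : Plane} {N M : ℕ} {F : Plane → KahlerAlgebra}
    {c : KahlerAlgebra} (h : SuccessiveSubtraction q N F c) (hNM : N ≤ M) :
    SuccessiveSubtraction q M F c := by
  cases h with
  | noPole hF => exact .noPole hF
  | simplePole hN hF => exact .simplePole (hN.trans hNM) hF
  | subtract hm hN hF hc => exact .subtract hm (hN.trans hNM) hF hc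

/-- Each subtraction removes a term of exponent at most -2, so β (-1) survives. At the end it is the
limit of (z - z₀) F, which is 0 if F has a limit. -/
theorem SuccessiveSubtraction.eq_residue {q : Plane} {N : ℕ} {F : Plane → KahlerAlgebra}
    {c : KahlerAlgebra} (h : SuccessiveSubtraction q N F c) :
    ∀ {W : ℂ → ℂ} {β : ℤ → ℂ}, F = evenFun W → IsLaurent W (toC q) β → c = toK (β (-1)) := by
  induction h with
  | noPole hF =>
    rintro W β rfl hβ
    rw [← toK_evenPart_of_tendsto hF, tendsto_evenFun_iff] at hF
    have h0 := tendsto_pow_mul_zero (n := 0) (m := 1) one_pos (by simpa using hF)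
    rw [hβ.residue_eq_of_tendsto (by simpa using h0), map_zero]
  | simplePole _ hF =>
    rintro W β rfl hβ
    obtain ⟨-, r, -, rfl, ht⟩ := hasPole_evenFun_iff.1 hF
    rw [hβ.residue_eq_of_tendsto (by simpa using ht)]
  | @subtract N m F a c hm _ hF _ ih =>
    rintro W β rfl hβ
    obtain ⟨-, r, -, rfl, -⟩ := hasPole_evenFun_iff.1 hF
    rw [ih (subtractPole_evenFun W q m r) (hβ.sub_monomial _ r)]
    rw [if_neg (by omega), sub_zero]

/-- Induction on a bound for the order of the pole. Either the coefficient at the bound vanishes and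
the bound drops, or it is the leading coefficient of a pole of exactly that order, and subtracting
it lowers the bound (at order 1 the procedure stops instead). -/
theorem successiveSubtraction_residue {q : Plane} (N : ℕ) :
    ∀ {W : ℂ → ℂ} {β : ℤ → ℂ}, IsLaurent W (toC q) β → (∀ n < -(N : ℤ), β n = 0) →
      SuccessiveSubtraction q N (evenFun W) (toK (β (-1))) := by
  induction N with
  | zero =>
    intro W β hβ h0
    rw [h0 (-1) (by norm_num), map_zero]
    exact .noPole (tendsto_evenFun_iff.2 (hβ.tendsto_of_nonneg (by simpa using h0)))
  | succ N ih =>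
    intro W β hβ h0
    by_cases hN : β (-((N + 1 : ℕ) : ℤ)) = 0
    · refine (ih hβ fun n hn => ?_).mono (Nat.le_succ N)
      rcases (show n ≤ -((N + 1 : ℕ) : ℤ) by push_cast; omega).eq_or_lt with rfl | h
      · exact hN
      · exact h0 n h
    · have hpole : HasPole (evenFun W) q (N + 1) (toK (β (-((N + 1 : ℕ) : ℤ)))) := by
        refine hasPole_evenFun_iff.2 ⟨by omega, _, hN, rfl, ?_⟩
        have := (hβ.zpow_mul ((N + 1 : ℕ) : ℤ)).tendsto_of_nonneg fun n hn => h0 _ (by omega)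
        rw [zero_sub] at this
        simpa only [zpow_natCast] using this
      rcases Nat.eq_zero_or_pos N with rfl | hN0
      · exact .simplePole le_rfl hpole
      · refine .subtract (by omega) le_rfl hpole ?_
        rw [subtractPole_evenFun, Nat.add_sub_cancel]
        have h1 := ih (hβ.sub_monomial (-((N + 1 : ℕ) : ℤ)) (β (-((N + 1 : ℕ) : ℤ)))) ?_
        · rwa [if_neg (by omega), sub_zero] at h1
        · intro n hn
          split_ifs with h
          · rw [h, sub_self]
          · rw [h0 n (by push_cast at h ⊢; omega), sub_zero]

theorem HasPole.successiveSubtraction_iff {W : ℂ → ℂ} {q : Plane} {m : ℕ} {a : KahlerAlgebra}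
    {β : ℤ → ℂ} (h : HasPole (evenFun W) q m a) (hβ : IsLaurent W (toC q) β) (v : KahlerAlgebra) :
    SuccessiveSubtraction q m (evenFun W) v ↔ v = toK (β (-1)) := by
  refine ⟨fun hv => hv.eq_residue rfl hβ, ?_⟩
  rintro rfl
  obtain ⟨-, r, -, -, ht⟩ := hasPole_evenFun_iff.1 h
  exact successiveSubtraction_residue m hβ fun n hn => hβ.coeff_eq_zero_of_tendsto ht hn

/-! ### Conclusion -/

/-- Supplies continuity on small circles, which is needed to take the imaginary part under the
integral. -/
theorem IsLaurent.eventually_differentiableAt {W : ℂ → ℂ} {z₀ : ℂ} {β : ℤ → ℂ}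
    (h : IsLaurent W z₀ β) : ∀ᶠ z in 𝓝[≠] z₀, DifferentiableAt ℂ W z := by
  obtain ⟨E, H, hE, -, hH, -, hW⟩ := h.exists_decomposition
  filter_upwards [eventually_eventually_nhdsWithin.2 hW, nhdsWithin_le_nhds hE,
    self_mem_nhdsWithin] with z hz hEz hne
  have hne' : z - z₀ ≠ 0 := sub_ne_zero.2 hne
  rw [(isOpen_compl_singleton).nhdsWithin_eq hne] at hz
  refine DifferentiableAt.congr_of_eventuallyEq ?_ hz
  have h1 : DifferentiableAt ℂ (fun z => (z - z₀)⁻¹) z := by fun_prop (disch := assumption)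
  have h2 : DifferentiableAt ℂ (fun z => H (z - z₀)⁻¹) z := (hH _).comp z h1
  fun_prop (disch := first | assumption | exact pow_ne_zero 2 hne')

theorem IsLaurent.integral_circle_im {W : ℂ → ℂ} {z₀ : ℂ} {β : ℤ → ℂ} (h : IsLaurent W z₀ β) :
    ∀ᶠ ρ : ℝ in 𝓝[>] 0, ∫ φ in (0 : ℝ)..2 * Real.pi,
      (W (z₀ + ρ * Complex.exp (φ * Complex.I))).im = 2 * Real.pi * (β 0).im := by
  obtain ⟨ε, hε, hd⟩ := eventually_nhdsNE_iff.1 h.eventually_differentiableAt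
  filter_upwards [h.integral_circle, Ioo_mem_nhdsGT hε] with ρ hρ hρε
  have hc : Continuous fun φ : ℝ => W (z₀ + ρ * Complex.exp (φ * Complex.I)) := by
    refine continuous_iff_continuousAt.2 fun φ => ?_
    refine ContinuousAt.comp (g := W) (hd _ ?_ ?_).continuousAt (by fun_prop)
    · simp [hρε.1.ne', Complex.exp_ne_zero]
    · simpa [Complex.norm_exp_ofReal_mul_I, abs_of_pos hρε.1] using hρε.2
  have := Complex.imCLM.intervalIntegral_comp_comm 
    (hc.intervalIntegrable (μ := volume) 0 (2 * Real.pi))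
  simp only [Complex.imCLM_apply] at this
  rw [this, hρ]
  simp

/-- The complex function `k - g i` attached to the 1-form `k dx + g dy`. -/
def complexCoeff (k g : Plane → ℝ) (z : ℂ) : ℂ := ⟨k (z.re, z.im), -g (z.re, z.im)⟩

theorem wFun_eq_evenFun (k g : Plane → ℝ) : wFun k g = evenFun (complexCoeff k g) := by
  funext p
  simp [wFun, evenFun, toK_apply, complexCoeff]

theorem oneForm_eq_reForm (k g : Plane → ℝ) : oneForm k g = reForm (complexCoeff k g) := by
  funext p
  ext <;> simp [oneForm, reForm_apply, complexCoeff]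

theorem ClosedOn.isClosedAt {k g : Plane → ℝ} {U : Set Plane} (h : ClosedOn k g U) {p : Plane}
    (hp : p ∈ U) : IsClosedAt (oneForm k g) p := by
  obtain ⟨hk, hg, hkg⟩ := h p hp
  have hd : HasFDerivAt (oneForm k g) _ p :=
    (hk.hasFDerivAt.smul_const (ContinuousLinearMap.fst ℝ ℝ ℝ)).add
      (hg.hasFDerivAt.smul_const (ContinuousLinearMap.snd ℝ ℝ ℝ))
  refine ⟨hd.differentiableAt, fun u v => ?_⟩
  have h0 : curl (oneForm k g) p = 0 := by
    rw [curl, hd.fderiv]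
    simp [hkg]
  rw [← sub_eq_zero, fderiv_sub_fderiv_swap, h0, zero_mul]

/-- The vector ∂/∂φ' is i (z - z₀), and Re(i (z - z₀) f) = -Im((z - z₀) f). -/
theorem angularCoeff_eq (k g : Plane → ℝ) (q p : Plane) :
    angularCoeff k g q p = -areaPart (zMul q (wFun k g) p) := by
  rw [wFun_eq_evenFun, zMul_evenFun, evenFun, areaPart_toK, angularCoeff]
  simp [oneForm, complexCoeff]
  ring

/-- Two expansions of one function have the same constant term, since both equal its mean over a
common small circle. -/
theorem IsLaurent.isConstantTerm {W : ℂ → ℂ} {q : Plane} {β : ℤ → ℂ} (h : IsLaurent W (toC q) β) :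
    IsConstantTerm (zMul q (evenFun W)) q (toK (β (-1))) := by
  have h1 : IsLaurent (fun z => (z - toC q) * W z) (toC q) (fun n => β (n - 1)) := by
    simpa using h.zpow_mul 1
  rw [zMul_evenFun]
  refine ⟨⟨_, isIntegerSeries_evenFun.2 h1⟩, fun b hb => ?_⟩
  obtain ⟨β', hβ', hb'⟩ := hb.exists_isLaurent
  obtain ⟨ρ, h2, h3⟩ := (h1.integral_circle.and hβ'.integral_circle).exists
  have hpi : (2 * Real.pi : ℂ) ≠ 0 := by simp [Real.pi_ne_zero]
  rw [hb', mul_left_cancel₀ hpi (h3.symm.trans h2), zero_sub]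

theorem IsLaurent.tendsto_integral_angularCoeff {k g : Plane → ℝ} {q : Plane} {β : ℤ → ℂ}
    (h : IsLaurent (complexCoeff k g) (toC q) β) :
    Tendsto (fun ρ : ℝ => ∫ φ in (0 : ℝ)..(2 * Real.pi),
        angularCoeff k g q (q.1 + ρ * Real.cos φ, q.2 + ρ * Real.sin φ))
      (𝓝[>] 0) (𝓝 (-2 * Real.pi * (β (-1)).im)) := by
  -- The integral does not depend on ρ once ρ is small.
  refine tendsto_const_nhds.congr' ?_
  have h1 : IsLaurent (fun z => (z - toC q) * complexCoeff k g z) (toC q)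
      (fun n => β (n - 1)) := by simpa using h.zpow_mul 1
  filter_upwards [h1.integral_circle_im] with ρ hρ
  have hpt : ∀ φ : ℝ, toC (q.1 + ρ * Real.cos φ, q.2 + ρ * Real.sin φ) =
      toC q + ρ * Complex.exp (φ * Complex.I) := fun φ => by
    apply Complex.ext <;> simp [Complex.exp_ofReal_mul_I_re, Complex.exp_ofReal_mul_I_im]
  simp only [angularCoeff_eq, wFun_eq_evenFun, zMul_evenFun, evenFun, areaPart_toK, hpt,
    intervalIntegral.integral_neg, hρ, zero_sub]
  ring

/-! ### The enclosed singularities -/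

section Enclosed

variable {D S : Set Plane} {a : Plane} {γ : Path a a}

/-- Infinitely many such points would accumulate in the compact set K. An accumulation point in S is
not isolated, and one outside S lies in the open set D \ S, which contains no point of S. -/
theorem finite_inter_enclosed (hDS : IsOpen (D \ S)) (hisol : ∀ q ∈ S, ∀ᶠ p in 𝓝[≠] q, p ∉ S)
    (hγD : range γ ⊆ D \ S) (henc : enclosed γ ⊆ D) : (S ∩ enclosed γ).Finite := by
  by_contra hinf
  obtain ⟨p, hp, hacc⟩ := Set.Infinite.exists_accPt_of_subset_isCompact hinf
    (isCompact_range_union_enclosed (γ := γ)) (inter_subset_right.trans subset_union_right)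
  rw [accPt_iff_frequently_nhdsNE] at hacc
  refine hacc ?_
  have hS : ∀ᶠ x in 𝓝[≠] p, x ∉ S := by
    by_cases hpS : p ∈ S
    · exact hisol p hpS
    · have hpD : p ∈ D := hp.elim (fun h => (hγD h).1) fun h => henc h
      exact nhdsWithin_le_nhds (eventually_of_mem (hDS.mem_nhds ⟨hpD, hpS⟩) fun x hx => hx.2)
  filter_upwards [hS] with x hx hx'
  exact hx hx'.1

/-- This is the neighbourhood on which the residue theorem is applied: singular points that are not
enclosed are discarded, and enclosed ones are interior because they are isolated in S. -/
theorem isOpen_sdiff_union_inter_enclosed (hD : IsOpen D) (hDS : IsOpen (D \ S))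
    (hisol : ∀ q ∈ S, ∀ᶠ p in 𝓝[≠] q, p ∉ S) (henc : enclosed γ ⊆ D) :
    IsOpen (D \ S ∪ S ∩ enclosed γ) := by
  rw [isOpen_iff_mem_nhds]
  rintro p (hp | hp)
  · exact mem_of_superset (hDS.mem_nhds hp) subset_union_left
  · filter_upwards [hD.mem_nhds (henc hp.2), eventually_nhdsWithin_iff.1 (hisol p hp.1)] with x hx h
    by_cases hxp : x = p
    · exact Or.inr (hxp ▸ hp)
    · exact Or.inl ⟨hx, h hxp⟩

end Enclosed

/-- The residue theorem for a closed 1-form whose singularities have Laurent expansions. -/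
theorem PiecewiseC1.curveIntegral_eq_sum_residues {k g : Plane → ℝ} {D S : Set Plane}
    (hD : IsOpen D) (hDS : IsOpen (D \ S)) (hisol : ∀ q ∈ S, ∀ᶠ p in 𝓝[≠] q, p ∉ S)
    (hclosed : ClosedOn k g (D \ S)) {a : Plane} {γ : Path a a} (hγ : PiecewiseC1 γ)
    (hγD : range γ ⊆ D \ S) (henc : enclosed γ ⊆ D) {T : Finset Plane}
    (hT : (T : Set Plane) = S ∩ enclosed γ) {β : Plane → ℤ → ℂ}
    (hβ : ∀ q ∈ T, IsLaurent (complexCoeff k g) (toC q) (β q)) :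
    curveIntegral (oneForm k g) γ =
      ∑ q ∈ T, -(2 * Real.pi) * (β q (-1)).im * windingNumber γ q := by
  choose! E H hE _ hH _ hW using fun q hq => (hβ q hq).exists_decomposition
  have hTmem : ∀ q, q ∈ T ↔ q ∈ S ∩ enclosed γ := fun q => by rw [← hT, Finset.mem_coe]
  have hTγ : ∀ q ∈ T, q ∉ range γ := fun q hq => ((hTmem q).1 hq).2.1
  rw [hγ.curveIntegral_eq_sum (isOpen_sdiff_union_inter_enclosed hD hDS hisol henc)
    (hγD.trans subset_union_left) (fun p hp => ?_)
    (σ := fun q => reForm (singularPart (β q (-1)) (H q) q)) T hTγ]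
  · exact Finset.sum_congr rfl fun q hq =>
      hγ.curveIntegral_singularPart _ (hH q hq) (hTγ q hq)
  · rintro p (hp | hp) hpT
    · exact hclosed.isClosedAt hp
    · exact absurd ((hTmem p).2 hp) hpT
  · exact fun q hq p hp => isClosedAt_reForm (differentiableAt_singularPart _ (hH q hq) hp)
  · intro q hq
    refine ⟨reForm (E q), isClosedAt_reForm (hE q hq).self_of_nhds, ?_⟩
    filter_upwards [eventually_toC.2 (hW q hq)] with p hp
    rw [oneForm_eq_reForm]
    ext <;> simp [reForm_apply, hp, singularPart]
  · by_cases hpS : p ∈ S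
    · exact Or.inr ⟨hpS, hp⟩
    · exact Or.inl ⟨henc hp, hpS⟩

end KahlerPlane

end

open KahlerPlane
theorem mainTheorem1 (k g : Plane → ℝ) (D S : Set Plane)
    (hD : IsOpen D) (hDS : IsOpen (D \ S))
    (hisol : ∀ q ∈ S, ∀ᶠ p in 𝓝[≠] q, p ∉ S)
    (hclosed : ClosedOn k g (D \ S))
    (a : Plane) (γ : Path a a) (hγ : PiecewiseC1 γ)
    (hγD : range γ ⊆ D \ S) (henc : enclosed γ ⊆ D)
    (hturn : ∀ q ∈ S ∩ enclosed γ, windingNumber γ q = 1)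
    (hw : ∀ q ∈ S ∩ enclosed γ, ∃ b, IsIntegerSeries (wFun k g) q b) :
    ∃ c : Plane → KahlerAlgebra,
      (∀ q ∈ S ∩ enclosed γ, IsConstantTerm (zMul q (wFun k g)) q (c q)) ∧
      (S ∩ enclosed γ).Finite ∧
      CurveIntegrable (oneForm k g) γ ∧
      curveIntegral (oneForm k g) γ =
        -2 * Real.pi * ∑ᶠ q ∈ S ∩ enclosed γ, areaPart (c q) ∧
      (∀ q p : Plane, angularCoeff k g q p = -areaPart (zMul q (wFun k g) p)) ∧
      (∀ q ∈ S ∩ enclosed γ,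
        Tendsto (fun ρ : ℝ => ∫ φ in (0 : ℝ)..(2 * Real.pi),
            angularCoeff k g q (q.1 + ρ * Real.cos φ, q.2 + ρ * Real.sin φ))
          (𝓝[>] 0) (𝓝 (-2 * Real.pi * areaPart (c q)))) ∧
      (∀ q ∈ S ∩ enclosed γ, ∀ r, HasPole (wFun k g) q 1 r →
        Tendsto (fun p => areaPart (zMul q (wFun k g) p)) (𝓝[≠] q) (𝓝 (areaPart (c q)))) ∧
      (∀ q ∈ S ∩ enclosed γ, ∀ m r, HasPole (wFun k g) q m r →
        (∀ m' r', HasPole (subtractPole (wFun k g) q m r) q m' r' → m' ≤ m - 1) ∧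
        (∀ v, SuccessiveSubtraction q m (wFun k g) v ↔ v = c q)) := by
  have hex : ∀ q ∈ S ∩ enclosed γ, ∃ β, IsLaurent (complexCoeff k g) (toC q) β := fun q hq => by
    obtain ⟨b, hb⟩ := hw q hq
    rw [wFun_eq_evenFun] at hb
    obtain ⟨β, hβ, -⟩ := hb.exists_isLaurent
    exact ⟨β, hβ⟩
  choose! β hβ using hex
  have hfin := finite_inter_enclosed hDS hisol hγD henc
  -- Multiplication by z - z₀ shifts exponents by one, so the constant term is the coefficient of w
  -- at exponent -1.
  refine ⟨fun q => toK (β q (-1)), fun q hq => ?_, hfin, ?_, ?_, angularCoeff_eq k g,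
    fun q hq => ?_, fun q hq r hr => ?_, fun q hq m r hr => ?_⟩
  · rw [wFun_eq_evenFun]
    exact (hβ q hq).isConstantTerm
  · exact hγ.curveIntegrable fun p hp =>
      (hclosed.isClosedAt (hγD hp)).1.continuousAt.continuousWithinAt
  · rw [hγ.curveIntegral_eq_sum_residues hD hDS hisol hclosed hγD henc (T := hfin.toFinset)
      hfin.coe_toFinset fun q hq => hβ q (hfin.mem_toFinset.1 hq),
      finsum_mem_eq_finite_toFinset_sum _ hfin, Finset.mul_sum]
    refine Finset.sum_congr rfl fun q hq => ?_
    rw [hturn q (hfin.mem_toFinset.1 hq), areaPart_toK]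
    ring
  · rw [areaPart_toK]
    exact (hβ q hq).tendsto_integral_angularCoeff
  · rw [wFun_eq_evenFun] at hr ⊢
    have ht := hr.tendsto
    obtain ⟨-, s, -, rfl, hs⟩ := hasPole_evenFun_iff.1 hr
    simp only [(hβ q hq).residue_eq_of_tendsto (l := s) (by simpa using hs)]
    simp only [pow_one] at ht
    exact (continuous_areaPart.tendsto _).comp ht
  · rw [wFun_eq_evenFun] at hr ⊢
    exact ⟨fun m' r' h' => hr.order_subtractPole_le h',
      fun v => hr.successiveSubtraction_iff (hβ q hq) v⟩
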